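/- Let $\zeta=\xi_1+i\xi_2$ and let $R_1,R_2$ (the Riesz transforms of the plane) and $T$ (the Ahlfors--Beurling transform) be the Fourier multiplier operators on the complex space $L^2(\mathbb R^2)$ with symbols $\xi_1/|\xi|$, $\xi_2/|\xi|$ and $\zeta/\bar\zeta$, respectively. For $1<p<\infty$ put $p^*=\max\bigl(p,\tfrac{p}{p-1}\bigr)$. For a bounded operator $S$ on $L^2(\mathbb R^2)$, write $\|S\|_p\le C$ if the restriction of $S$ to $L^2(\mathbb R^2)\cap L^p(\mathbb R^2)$ has a unique bounded linear extension to the complex space $L^p(\mathbb R^2)$ and this extension has operator norm at most $C$. **Theorem.** For every $2\le p<\infty$, $$\|R_1^2-R_2^2\|_p\le p-1 .$$ Moreover, for every $1<p<\infty$, $$\|T\|_p\le 2(p^*-1).$$ -/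

import Mathlib

open MeasureTheory FourierTransform

open scoped ENNReal ComplexConjugate

/-- The plane `ℝ²` with its Euclidean structure (and Lebesgue measure `volume`). -/
abbrev Plane : Type := EuclideanSpace ℝ (Fin 2)

/-- The bounded operator `f ↦ 𝓕⁻¹ (m · 𝓕 f)` on complex `L²(ℝ²)`, for an essentially bounded
measurable symbol `m`; here `𝓕` is the Plancherel extension of
`𝓕 f (ξ) = ∫ f(x) exp(-2πi ⟨x, ξ⟩) dx`. -/
noncomputable def multiplierOp (m : Plane → ℂ) (hm : MemLp m ∞ (volume : Measure Plane)) :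
    Lp ℂ 2 (volume : Measure Plane) →L[ℂ] Lp ℂ 2 (volume : Measure Plane) :=
  ((Lp.fourierTransformₗᵢ Plane ℂ).symm.toContinuousLinearEquiv.toContinuousLinearMap) ∘L
    ((ContinuousLinearMap.mul ℂ ℂ).holderL volume ∞ 2 2 (hm.toLp m)) ∘L
    ((Lp.fourierTransformₗᵢ Plane ℂ).toContinuousLinearEquiv.toContinuousLinearMap)

/-- The symbol `ξ_j / |ξ|` of the `j`-th Riesz transform (`j = 0, 1` stands for `1, 2`). -/
noncomputable def rieszSymbol (j : Fin 2) (ξ : Plane) : ℂ := ((ξ j / ‖ξ‖ : ℝ) : ℂ)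

/-- The symbol `ζ / conj ζ`, `ζ = ξ₁ + i ξ₂`, of the Ahlfors--Beurling transform. -/
noncomputable def ahlforsBeurlingSymbol (ξ : Plane) : ℂ :=
  ((ξ 0 : ℂ) + Complex.I * (ξ 1 : ℂ)) / conj ((ξ 0 : ℂ) + Complex.I * (ξ 1 : ℂ))

theorem memLp_top_rieszSymbol (j : Fin 2) :
    MemLp (rieszSymbol j) ∞ (volume : Measure Plane) := by
  refine memLp_top_of_bound (Measurable.aestronglyMeasurable ?_) 1 (.of_forall fun ξ => ?_)
  · unfold rieszSymbol
    fun_prop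
  · rw [rieszSymbol, Complex.norm_real, norm_div, norm_norm]
    exact div_le_one_of_le₀ (PiLp.norm_apply_le ξ j) (norm_nonneg _)

theorem memLp_top_ahlforsBeurlingSymbol :
    MemLp ahlforsBeurlingSymbol ∞ (volume : Measure Plane) := by
  refine memLp_top_of_bound (Measurable.aestronglyMeasurable ?_) 1 (.of_forall fun ξ => ?_)
  · unfold ahlforsBeurlingSymbol
    fun_prop
  · rw [ahlforsBeurlingSymbol, norm_div, RCLike.norm_conj]
    exact div_self_le_one _

/-- The Riesz transforms of the plane, as Fourier multipliers on `L²(ℝ²)`. -/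
noncomputable def rieszTransform (j : Fin 2) :
    Lp ℂ 2 (volume : Measure Plane) →L[ℂ] Lp ℂ 2 (volume : Measure Plane) :=
  multiplierOp (rieszSymbol j) (memLp_top_rieszSymbol j)

/-- The Ahlfors--Beurling transform, as a Fourier multiplier on `L²(ℝ²)`. -/
noncomputable def ahlforsBeurling :
    Lp ℂ 2 (volume : Measure Plane) →L[ℂ] Lp ℂ 2 (volume : Measure Plane) :=
  multiplierOp ahlforsBeurlingSymbol memLp_top_ahlforsBeurlingSymbol

/-- `A` is an extension to `L^q(ℝ²)` of the restriction of the `L²` operator `S` to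
`L²(ℝ²) ∩ L^q(ℝ²)`. -/
def IsLpExtension (q : ℝ≥0∞) [Fact (1 ≤ q)]
    (S : Lp ℂ 2 (volume : Measure Plane) →L[ℂ] Lp ℂ 2 (volume : Measure Plane))
    (A : Lp ℂ q (volume : Measure Plane) →L[ℂ] Lp ℂ q (volume : Measure Plane)) : Prop :=
  ∀ (f : Lp ℂ 2 (volume : Measure Plane)) (g : Lp ℂ q (volume : Measure Plane)),
    f =ᵐ[volume] g → S f =ᵐ[volume] A g

/-- The norm of `S` on `L^q(ℝ²)` is at most `C`: `S`, restricted to `L² ∩ L^q`, has exactly one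
bounded extension to `L^q`, and the operator norm of this extension is at most `C`. -/
def LpNormLE (q : ℝ≥0∞) [Fact (1 ≤ q)]
    (S : Lp ℂ 2 (volume : Measure Plane) →L[ℂ] Lp ℂ 2 (volume : Measure Plane)) (C : ℝ) : Prop :=
  ∃ A : Lp ℂ q (volume : Measure Plane) →L[ℂ] Lp ℂ q (volume : Measure Plane),
    (∀ A', IsLpExtension q S A' ↔ A' = A) ∧ ‖A‖ ≤ C

/-! Both operators are limits of averaged martingale transforms, to which Burkholder's sharp bound
`p* - 1` applies. Start a symmetric walk from the invariant measure. Evaluating `f` at its endpoint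
generates a martingale along the walk; multiply its increments by unimodular constants and average
the result over all walks with a given endpoint. This is `walkTransform`.

For `p ≥ 2` its norm is at most `p - 1`, by a Bellman induction with Burkholder's function `U`.
Three facts drive it: `U` is midpoint concave along steps `(h, k)` with `‖k‖ = ‖h‖`
(`burkholder_zigzag`), a positive multiple of `U` majorizes `‖y‖ ^ p - (p - 1) ^ p * ‖x‖ ^ p`
(`norm_rpow_sub_le_burkholder`), and `U(x, 0) ≤ 0`. Exponents `p < 2` follow by duality, because the
transform is symmetric for the bilinear pairing.

On the Fourier side the transform is a multiplier built from cosines (`hasSymbol_walkTransform`).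
Alternating small steps along `v` and `w` with multipliers `1` and `-1` gives, in the limit, the
symbol `(⟪v, ξ⟫² - ⟪w, ξ⟫²) / (⟪v, ξ⟫² + ⟪w, ξ⟫²)`, and `L^p` bounds survive the limit
(`HasSymbol.eLpNorm_le_of_tendsto`). The coordinate axes give `R₁² - R₂²`, the diagonals give `2 R₁
R₂`, and `T = (R₁² - R₂²) + i · 2 R₁ R₂` costs a factor `2` by the triangle inequality. -/

/-- Burkholder's function (up to a constant), for exponents `p ≥ 2`. -/
noncomputable def burkholder {E : Type*} [Norm E] (p : ℝ) (x y : E) : ℝ :=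
  (‖y‖ - (p - 1) * ‖x‖) * (‖x‖ + ‖y‖) ^ (p - 1)

/-- The density of the layer cake representation of `burkholder`. -/
noncomputable def burkholderLayer {E : Type*} [Norm E] (p : ℝ) (x y : E) (r : ℝ) : ℝ :=
  if r < ‖x‖ + ‖y‖ then
    (‖y‖ ^ 2 - ‖x‖ ^ 2) * r ^ (p - 3) - 2 * ‖y‖ * r ^ (p - 2) + r ^ (p - 1) else 0

/-! ### Layer cake representation of Burkholder's function. -/

section Layer

variable {E : Type*} [NormedAddCommGroup E] {p : ℝ}

/-- This factored form carries the geometry; the expanded one in the definition makes integrability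
at `0` visible, since `p - 3 > -1`. -/
theorem burkholderLayer_eq (x y : E) {r : ℝ} (hr : 0 < r) :
    burkholderLayer p x y r =
      r ^ (p - 3) * (if r < ‖x‖ + ‖y‖ then (‖y‖ - r) ^ 2 - ‖x‖ ^ 2 else 0) := by
  unfold burkholderLayer
  have h1 : r ^ (p - 2) = r ^ (p - 3) * r := by
    rw [← Real.rpow_add_one hr.ne']; ring_nf
  have h2 : r ^ (p - 1) = r ^ (p - 3) * r ^ 2 := by
    rw [show p - 1 = p - 3 + 2 by ring, Real.rpow_add hr]; norm_num
  split_ifs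
  · rw [h1, h2]; ring
  · simp

theorem intervalIntegrable_burkholderLayer_and_integral (hp : 2 < p) (x y : E) {R : ℝ}
    (hR : ‖x‖ + ‖y‖ ≤ R) :
    IntervalIntegrable (burkholderLayer p x y) volume 0 R ∧
      ∫ r in 0..R, burkholderLayer p x y r =
        2 / (p * (p - 1) * (p - 2)) * burkholder p x y := by
  set w := ‖x‖ + ‖y‖ with hw
  have hw0 : 0 ≤ w := by positivity
  set g : ℝ → ℝ := fun r =>
    (‖y‖ ^ 2 - ‖x‖ ^ 2) * r ^ (p - 3) - 2 * ‖y‖ * r ^ (p - 2) + r ^ (p - 1) with hg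
  have i1 : IntervalIntegrable (fun r : ℝ => (‖y‖ ^ 2 - ‖x‖ ^ 2) * r ^ (p - 3)) volume 0 w :=
    (intervalIntegral.intervalIntegrable_rpow' (by linarith)).const_mul _
  have i2 : IntervalIntegrable (fun r : ℝ => 2 * ‖y‖ * r ^ (p - 2)) volume 0 w :=
    (intervalIntegral.intervalIntegrable_rpow' (by linarith)).const_mul _
  have i3 : IntervalIntegrable (fun r : ℝ => r ^ (p - 1)) volume 0 w :=
    intervalIntegral.intervalIntegrable_rpow' (by linarith)
  have ig : IntervalIntegrable g volume 0 w := (i1.sub i2).add i3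
  have e1 : ∀ᵐ r : ℝ, r ∈ Set.uIoc 0 w → g r = burkholderLayer p x y r := by
    filter_upwards [Measure.ae_ne volume w] with r hr hr'
    rw [Set.uIoc_of_le hw0] at hr'
    simp [burkholderLayer, ← hw, lt_of_le_of_ne hr'.2 hr, hg]
  have e2 : ∀ r ∈ Set.uIoc w R, 0 = burkholderLayer p x y r := by
    intro r hr
    rw [Set.uIoc_of_le hR] at hr
    simp [burkholderLayer, ← hw, not_lt.2 hr.1.le]
  have j1 : IntervalIntegrable (burkholderLayer p x y) volume 0 w :=
    ig.congr_ae ((ae_restrict_iff' measurableSet_uIoc).2 e1)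
  have j2 : IntervalIntegrable (burkholderLayer p x y) volume w R :=
    (intervalIntegrable_const (c := (0 : ℝ))).congr e2
  refine ⟨j1.trans j2, ?_⟩
  rw [← intervalIntegral.integral_add_adjacent_intervals j1 j2,
    ← intervalIntegral.integral_congr_ae e1,
    ← intervalIntegral.integral_congr_ae (.of_forall e2), hg,
    intervalIntegral.integral_add (i1.sub i2) i3, intervalIntegral.integral_sub i1 i2,
    intervalIntegral.integral_const_mul, intervalIntegral.integral_const_mul,
    integral_rpow (.inl (by linarith)), integral_rpow (.inl (by linarith)),
    integral_rpow (.inl (by linarith)), Real.zero_rpow (by linarith), Real.zero_rpow (by linarith),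
    Real.zero_rpow (by linarith), burkholder, ← hw]
  rcases hw0.eq_or_lt with h0 | h0
  · rw [← h0, Real.zero_rpow (by linarith), Real.zero_rpow (by linarith),
      Real.zero_rpow (by linarith)]
    simp [Real.zero_rpow (show p - 1 ≠ 0 by linarith)]
  have h1 : w ^ (p - 1) = w ^ (p - 2) * w := by
    rw [← Real.rpow_add_one h0.ne']; ring_nf
  have h2 : w ^ (p - 1 + 1) = w ^ (p - 2) * w ^ 2 := by
    rw [show p - 1 + 1 = p - 2 + 2 by ring, Real.rpow_add h0]; norm_num
  have k1 : p - 2 ≠ 0 := by linarith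
  have k2 : p - 1 ≠ 0 := by linarith
  have k3 : p ≠ 0 := by linarith
  rw [h2, show p - 3 + 1 = p - 2 by ring, show p - 2 + 1 = p - 1 by ring, h1, hw]
  simp only [sub_zero, intervalIntegral.integral_zero, add_zero, sub_add_cancel]
  field_simp
  ring

end Layer

/-! ### Zigzag concavity. -/

section Zigzag

variable {E : Type*} [NormedAddCommGroup E] [InnerProductSpace ℝ E] {p : ℝ}

/-- In `(‖y‖ - r) ^ 2 - ‖x‖ ^ 2` the squares satisfy the parallelogram law, where `‖h‖ = ‖k‖`
cancels, and the remaining term `-2 * r * ‖y‖` is concave. -/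
theorem burkholderLayer_zigzag (x y h k : E) (hk : ‖k‖ = ‖h‖) {r : ℝ} (hr : 0 < r) :
    burkholderLayer p (x + h) (y + k) r + burkholderLayer p (x - h) (y - k) r ≤
      2 * burkholderLayer p x y r := by
  rw [burkholderLayer_eq _ _ hr, burkholderLayer_eq _ _ hr, burkholderLayer_eq _ _ hr, ← mul_add,
    mul_left_comm]
  refine mul_le_mul_of_nonneg_left ?_ (by positivity)
  have px := parallelogram_law_with_norm ℝ x h
  have py := parallelogram_law_with_norm ℝ y k
  have ty : 2 * ‖y‖ ≤ ‖y + k‖ + ‖y - k‖ := by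
    calc 2 * ‖y‖ = ‖(y + k) + (y - k)‖ := by
          rw [show (y + k) + (y - k) = (2 : ℝ) • y by rw [two_smul]; abel, norm_smul]; norm_num
      _ ≤ _ := norm_add_le _ _
  rw [hk] at py
  by_cases hz : r < ‖x‖ + ‖y‖
  -- Where the layer is cut off, `‖a‖ ≤ r - ‖b‖`, so the quadratic is nonnegative there and
  -- dominates the layer everywhere.
  · have key : ∀ a b : E, (if r < ‖a‖ + ‖b‖ then (‖b‖ - r) ^ 2 - ‖a‖ ^ 2 else 0) ≤
        (‖b‖ - r) ^ 2 - ‖a‖ ^ 2 := by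
      intro a b
      split_ifs with hab
      · exact le_rfl
      · nlinarith [norm_nonneg a, norm_nonneg b]
    rw [if_pos hz]
    have := key (x + h) (y + k)
    have := key (x - h) (y - k)
    nlinarith
  -- The midpoint value is `0`. Here `‖b‖ - r ≤ ‖y‖ + ‖x‖ + ‖a‖ - r ≤ ‖a‖`, and `r - ‖b‖ < ‖a‖` off
  -- the cutoff, so neither endpoint is positive.
  · have key : ∀ a b : E, ‖b‖ ≤ ‖y‖ + ‖h‖ → ‖h‖ ≤ ‖x‖ + ‖a‖ →
        (if r < ‖a‖ + ‖b‖ then (‖b‖ - r) ^ 2 - ‖a‖ ^ 2 else 0) ≤ 0 := by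
      intro a b h1 h2
      split_ifs with hab
      · nlinarith
      · exact le_rfl
    rw [if_neg hz]
    have h1 := key (x + h) (y + k) (hk ▸ norm_add_le _ _)
      (by simpa [add_comm] using norm_sub_le (x + h) x)
    have h2 := key (x - h) (y - k) (hk ▸ norm_sub_le _ _)
      (by simpa using norm_sub_le x (x - h))
    linarith

theorem burkholder_zigzag (hp : 2 ≤ p) (x y h k : E) (hk : ‖k‖ = ‖h‖) :
    burkholder p (x + h) (y + k) + burkholder p (x - h) (y - k) ≤ 2 * burkholder p x y := by
  -- At `p = 2` the layer constant degenerates, but the function is just `‖y‖ ^ 2 - ‖x‖ ^ 2`.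
  rcases hp.eq_or_lt with rfl | hp
  · have px := parallelogram_law_with_norm ℝ x h
    have py := parallelogram_law_with_norm ℝ y k
    rw [hk] at py
    norm_num [burkholder]
    nlinarith
  set R := max (‖x‖ + ‖y‖) (max (‖x + h‖ + ‖y + k‖) (‖x - h‖ + ‖y - k‖)) with hR
  have hR0 : 0 ≤ R := le_trans (by positivity) (le_max_left _ _)
  obtain ⟨i1, e1⟩ := intervalIntegrable_burkholderLayer_and_integral hp x y (R := R)
    (le_max_left _ _)
  obtain ⟨i2, e2⟩ := intervalIntegrable_burkholderLayer_and_integral hp (x + h) (y + k) (R := R)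
    ((le_max_left _ _).trans (le_max_right _ _))
  obtain ⟨i3, e3⟩ := intervalIntegrable_burkholderLayer_and_integral hp (x - h) (y - k) (R := R)
    ((le_max_right _ _).trans (le_max_right _ _))
  have := intervalIntegral.integral_mono_on_of_le_Ioo hR0 (i2.add i3) (i1.const_mul 2)
    fun r hr => burkholderLayer_zigzag (p := p) x y h k hk hr.1
  rw [intervalIntegral.integral_add i2 i3, intervalIntegral.integral_const_mul, e1, e2, e3,
    ← mul_add, mul_left_comm] at this
  have hc : 0 < 2 / (p * (p - 1) * (p - 2)) := by
    have : 0 < p - 2 := by linarith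
    have : 0 < p - 1 := by linarith
    positivity
  exact le_of_mul_le_mul_left this hc

end Zigzag

/-! ### Majorization and integrability of Burkholder's function. -/

theorem rpow_sub_rpow_le_mul_rpow {p b c : ℝ} (hp : 2 ≤ p) (hb : 0 ≤ b) (hc : 0 ≤ c) :
    b ^ p - c ^ p ≤ p * (b - c) * (((p - 1) * b + c) / p) ^ (p - 1) := by
  have hp0 : 0 < p := by linarith
  -- With `d = (b - c) / p` one has `c = b - p * d`, and the base on the right is `b - d`. The claim
  -- becomes `G 0 ≤ G d`: the derivative `p ^ 2 * (b - p * d) * ((b - d) ^ (p - 2) - (b - p * d) ^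
  -- (p - 2))` has the sign of `d`.
  set G : ℝ → ℝ := fun d => p ^ 2 * d * (b - d) ^ (p - 1) + (b - p * d) ^ p with hG
  have hder : ∀ d, HasDerivAt G (p ^ 2 * ((b - d) ^ (p - 1) - (p - 1) * d * (b - d) ^ (p - 2)
      - (b - p * d) ^ (p - 1))) d := by
    intro d
    have h1 : HasDerivAt (fun d : ℝ => (b - d) ^ (p - 1)) (-1 * (p - 1) * (b - d) ^ (p - 1 - 1)) d :=
      ((hasDerivAt_id d).const_sub b).rpow_const (.inr (by linarith))
    have h2 : HasDerivAt (fun d : ℝ => (b - p * d) ^ p) (-(p * 1) * p * (b - p * d) ^ (p - 1)) d :=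
      (((hasDerivAt_id d).const_mul p).const_sub b).rpow_const (.inr (by linarith))
    have h3 := (((hasDerivAt_id d).const_mul (p ^ 2)).mul h1).add h2
    rw [show p - 1 - 1 = p - 2 by ring] at h3
    refine h3.congr_deriv ?_
    simp only [id]
    ring
  have hder' : ∀ d, d ≤ b → 0 ≤ b - p * d → 0 ≤ b - d →
      deriv G d = p ^ 2 * ((b - p * d) * ((b - d) ^ (p - 2) - (b - p * d) ^ (p - 2))) := by
    intro d hd h1 h2
    rw [(hder d).deriv]
    rcases h2.eq_or_lt with h0 | h0
    · have hd0 : d = b := by linarith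
      subst hd0
      have : d = 0 ∨ d ≠ 0 := em _
      rcases this with rfl | hne
      · simp [Real.zero_rpow (show p - 1 ≠ 0 by linarith)]
      · exfalso
        have : 0 < d := lt_of_le_of_ne hb hne.symm
        nlinarith
    · rcases h1.eq_or_lt with h3 | h3
      · rw [← h3, Real.zero_rpow (show p - 1 ≠ 0 by linarith),
          show p - 1 = p - 2 + 1 by ring, Real.rpow_add_one h0.ne']
        have : b = p * d := by linarith
        rw [this]; ring
      · rw [show p - 1 = p - 2 + 1 by ring, Real.rpow_add_one h0.ne', Real.rpow_add_one h3.ne']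
        ring
  have hcont : Continuous G := continuous_iff_continuousAt.2 fun d => (hder d).continuousAt
  have hG0 : G 0 = b ^ p := by simp [hG]
  have key : ∀ d, d ≤ b / p → G 0 ≤ G d := by
    intro d hd
    have hbp : b / p ≤ b := div_le_self hb (by linarith)
    have hpos : ∀ d, d ≤ b / p → 0 ≤ b - p * d := fun d hd => by
      rw [le_div_iff₀ hp0] at hd; linarith
    rcases le_total 0 d with h0 | h0
    · refine monotoneOn_of_deriv_nonneg (convex_Icc 0 (b / p)) hcont.continuousOn
        (fun x _ => (hder x).differentiableAt.differentiableWithinAt) ?_ ⟨le_rfl, by positivity⟩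
        ⟨h0, hd⟩ h0
      intro x hx
      rw [interior_Icc] at hx
      have h1 := hpos x hx.2.le
      rw [hder' x (hx.2.le.trans hbp) h1 (by linarith [hx.2])]
      refine mul_nonneg (by positivity) (mul_nonneg h1 (sub_nonneg.2 ?_))
      exact Real.rpow_le_rpow h1 (by nlinarith [hx.1]) (by linarith)
    · refine antitoneOn_of_deriv_nonpos (convex_Iic 0) hcont.continuousOn
        (fun x _ => (hder x).differentiableAt.differentiableWithinAt) ?_ h0 (Set.mem_Iic.2 le_rfl)
        h0
      intro x hx
      rw [interior_Iic] at hx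
      have hx : x < 0 := hx
      have h1 : 0 ≤ b - p * x := by nlinarith
      rw [hder' x (by linarith) h1 (by linarith)]
      refine mul_nonpos_of_nonneg_of_nonpos (by positivity)
        (mul_nonpos_of_nonneg_of_nonpos h1 (sub_nonpos.2 ?_))
      exact Real.rpow_le_rpow (by linarith) (by nlinarith) (by linarith)
  have := key ((b - c) / p) (by gcongr; linarith)
  rw [hG0, hG] at this
  have e1 : b - p * ((b - c) / p) = c := by field_simp; ring
  have e2 : b - (b - c) / p = ((p - 1) * b + c) / p := by field_simp; ring
  simp only [e1, e2] at this
  have e3 : p ^ 2 * ((b - c) / p) = p * (b - c) := by field_simp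
  rw [e3] at this
  linarith

/-- The scalar inequality with `b = ‖y‖` and `c = (p - 1) * ‖x‖`; this choice turns the base into a
multiple of `‖x‖ + ‖y‖`. -/
theorem norm_rpow_sub_le_burkholder {E : Type*} [NormedAddCommGroup E] {p : ℝ} (hp : 2 ≤ p)
    (x y : E) :
    ‖y‖ ^ p - (p - 1) ^ p * ‖x‖ ^ p ≤ p * ((p - 1) / p) ^ (p - 1) * burkholder p x y := by
  have h1 : 0 ≤ p - 1 := by linarith
  have h0 : 0 < p := by linarith
  have := rpow_sub_rpow_le_mul_rpow hp (norm_nonneg y) (mul_nonneg h1 (norm_nonneg x))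
  rw [Real.mul_rpow h1 (norm_nonneg x)] at this
  refine this.trans_eq ?_
  rw [show ((p - 1) * ‖y‖ + (p - 1) * ‖x‖) / p = (p - 1) / p * (‖x‖ + ‖y‖) by ring,
    Real.mul_rpow (by positivity) (by positivity), burkholder]
  ring

theorem abs_burkholder_le {E : Type*} [NormedAddCommGroup E] {p : ℝ} (hp : 2 ≤ p) (x y : E) :
    |burkholder p x y| ≤ p * (‖x‖ + ‖y‖) ^ p := by
  have hx := norm_nonneg x
  have hy := norm_nonneg y
  rw [burkholder, abs_mul, abs_of_nonneg (Real.rpow_nonneg (by positivity) _)]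
  have h1 : |‖y‖ - (p - 1) * ‖x‖| ≤ p * (‖x‖ + ‖y‖) := by
    rw [abs_le]; constructor <;> nlinarith
  calc _ ≤ p * (‖x‖ + ‖y‖) * (‖x‖ + ‖y‖) ^ (p - 1) := by gcongr
    _ = p * (‖x‖ + ‖y‖) ^ p := by
      rw [mul_assoc, mul_comm (‖x‖ + ‖y‖), ← Real.rpow_add_one' (by positivity) (by linarith),
        sub_add_cancel]

theorem burkholder_zero_right_nonpos {E : Type*} [NormedAddCommGroup E] {p : ℝ} (hp : 2 ≤ p)
    (x : E) : burkholder p x 0 ≤ 0 := by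
  rw [burkholder, norm_zero, zero_sub]
  exact mul_nonpos_of_nonpos_of_nonneg
    (neg_nonpos.2 (mul_nonneg (by linarith) (norm_nonneg x))) (by positivity)

theorem continuous_burkholder {E : Type*} [NormedAddCommGroup E] {p : ℝ} (hp : 2 ≤ p) :
    Continuous fun z : E × E => burkholder p z.1 z.2 := by
  unfold burkholder
  refine Continuous.mul (by fun_prop) (Continuous.rpow_const (by fun_prop) fun _ => .inr ?_)
  linarith

theorem MeasureTheory.MemLp.integrable_norm_rpow_ofReal {G : Type*} [MeasurableSpace G]
    {μ : Measure G} {f : G → ℂ} {p : ℝ} (hp : 0 < p)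
    (hf : MemLp f (ENNReal.ofReal p) μ) : Integrable (fun x => ‖f x‖ ^ p) μ := by
  simpa [hp.le] using hf.integrable_norm_rpow (by simpa using hp) ENNReal.ofReal_ne_top

theorem integrable_burkholder {G : Type*} [MeasurableSpace G] {μ : Measure G}
    {f g : G → ℂ} {p : ℝ} (hp : 2 ≤ p)
    (hf : MemLp f (ENNReal.ofReal p) μ) (hg : MemLp g (ENNReal.ofReal p) μ) :
    Integrable (fun x => burkholder p (f x) (g x)) μ := by
  have h := (hf.norm.add hg.norm).integrable_norm_rpow (by simp; linarith) ENNReal.ofReal_ne_top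
  rw [ENNReal.toReal_ofReal (by linarith)] at h
  refine (h.const_mul p).mono' ((continuous_burkholder hp).comp_aestronglyMeasurable
    (hf.1.prodMk hg.1)) (.of_forall fun x => ?_)
  rw [Real.norm_eq_abs]
  refine (abs_burkholder_le hp _ _).trans_eq ?_
  rw [Pi.add_apply, Real.norm_of_nonneg (by positivity)]

theorem norm_half_add_rpow_le {p : ℝ} (hp : 1 ≤ p) (a b : ℂ) :
    ‖(a + b) / 2‖ ^ p ≤ (‖a‖ ^ p + ‖b‖ ^ p) / 2 := by
  have h := (convexOn_rpow hp).2 (norm_nonneg a) (norm_nonneg b)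
    (by norm_num : (0 : ℝ) ≤ 1 / 2) (by norm_num : (0 : ℝ) ≤ 1 / 2) (by norm_num)
  simp only [smul_eq_mul] at h
  have h2 : ‖(a + b) / 2‖ ≤ 1 / 2 * ‖a‖ + 1 / 2 * ‖b‖ := by
    rw [norm_div, Complex.norm_ofNat]
    linarith [norm_add_le a b]
  calc _ ≤ (1 / 2 * ‖a‖ + 1 / 2 * ‖b‖) ^ p := by gcongr
    _ ≤ _ := by linarith

/-! ### Martingale transforms along symmetric walks and their `L^p` bounds. -/

section Walk

variable {G : Type*} [AddCommGroup G]

/-- The average of `f` over one step `± v` of a symmetric walk. -/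
noncomputable def symAvg (v : G) : (G → ℂ) →ₗ[ℂ] (G → ℂ) where
  toFun f x := (f (x + v) + f (x - v)) / 2
  map_add' f g := by ext x; simp only [Pi.add_apply]; ring
  map_smul' c f := by ext x; simp only [Pi.smul_apply, smul_eq_mul, RingHom.id_apply]; ring

theorem symAvg_apply (v : G) (f : G → ℂ) (x : G) :
    symAvg v f x = (f (x + v) + f (x - v)) / 2 := rfl

/-- The average of `f` over a walk whose `n`-th step is `± v` with `v` the vector of the `n`-th
entry of the list. -/
noncomputable def iterAvg : List (G × ℂ) → (G → ℂ) →ₗ[ℂ] (G → ℂ)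
  | [] => LinearMap.id
  | s :: L => symAvg s.1 ∘ₗ iterAvg L

@[simp] theorem iterAvg_nil (f : G → ℂ) : iterAvg [] f = f := rfl

@[simp] theorem iterAvg_cons (s : G × ℂ) (L : List (G × ℂ)) (f : G → ℂ) :
    iterAvg (s :: L) f = symAvg s.1 (iterAvg L f) := rfl

/-- The average, over all walks ending at the given point, of the transform of the martingale
generated by `f` along the walk; the multiplier at the `n`-th step is the second component of the
`n`-th entry of the list. -/
noncomputable def walkTransform : List (G × ℂ) → (G → ℂ) → G → ℂ
  | [], _ => 0
  | s :: L, f => walkTransform L f +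
      s.2 • iterAvg L (iterAvg L f - symAvg s.1 (symAvg s.1 (iterAvg L f)))

@[simp] theorem walkTransform_nil (f : G → ℂ) : walkTransform [] f = 0 := rfl

theorem walkTransform_cons (s : G × ℂ) (L : List (G × ℂ)) (f : G → ℂ) :
    walkTransform (s :: L) f = walkTransform L f +
      s.2 • iterAvg L (iterAvg L f - symAvg s.1 (symAvg s.1 (iterAvg L f))) := rfl

theorem symAvg_comm (v w : G) (f : G → ℂ) : symAvg v (symAvg w f) = symAvg w (symAvg v f) := by
  ext x
  simp only [symAvg_apply]
  rw [show x + v + w = x + w + v by abel, show x + v - w = x - w + v by abel,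
    show x - v + w = x + w - v by abel, show x - v - w = x - w - v by abel]
  ring

theorem symAvg_iterAvg (v : G) (L : List (G × ℂ)) (f : G → ℂ) :
    symAvg v (iterAvg L f) = iterAvg L (symAvg v f) := by
  induction L with
  | nil => rfl
  | cons s L ih => rw [iterAvg_cons, iterAvg_cons, symAvg_comm, ih]

variable [MeasurableSpace G] [MeasurableAdd G] {μ : Measure G} [μ.IsAddRightInvariant]

theorem MeasureTheory.MemLp.comp_add_right {q : ℝ≥0∞} {f : G → ℂ} (hf : MemLp f q μ) (v : G) :
    MemLp (fun x => f (x + v)) q μ :=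
  hf.comp_measurePreserving (measurePreserving_add_right μ v)

theorem MeasureTheory.MemLp.comp_sub_right {q : ℝ≥0∞} {f : G → ℂ} (hf : MemLp f q μ) (v : G) :
    MemLp (fun x => f (x - v)) q μ := by
  simpa [sub_eq_add_neg] using hf.comp_add_right (-v)

theorem MeasureTheory.MemLp.symAvg {q : ℝ≥0∞} {f : G → ℂ} (hf : MemLp f q μ) (v : G) :
    MemLp (symAvg v f) q μ := by
  simpa [_root_.symAvg, div_eq_inv_mul, smul_eq_mul] using
    ((hf.comp_add_right v).add (hf.comp_sub_right v)).const_mul (2⁻¹ : ℂ)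

theorem MeasureTheory.MemLp.iterAvg {q : ℝ≥0∞} {f : G → ℂ} (hf : MemLp f q μ)
    (L : List (G × ℂ)) : MemLp (iterAvg L f) q μ := by
  induction L with
  | nil => exact hf
  | cons s L ih => exact ih.symAvg _

theorem MeasureTheory.MemLp.walkTransform {q : ℝ≥0∞} {f : G → ℂ} (hf : MemLp f q μ)
    (L : List (G × ℂ)) : MemLp (walkTransform L f) q μ := by
  induction L with
  | nil => exact MemLp.zero
  | cons s L ih =>
    have h := hf.iterAvg L
    exact ih.add (((h.sub ((h.symAvg _).symAvg _)).iterAvg L).const_smul s.2)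

/-- The Bellman induction. The function `y` is the value of the transformed process at the start of
the walk; it must vary, since removing the first step changes it. -/
theorem integral_walkTransform_le_integral_burkholder {p : ℝ} (hp : 2 ≤ p) {f : G → ℂ}
    (hf : MemLp f (ENNReal.ofReal p) μ) (L : List (G × ℂ)) (hL : ∀ s ∈ L, ‖s.2‖ = 1) {y : G → ℂ}
    (hy : MemLp y (ENNReal.ofReal p) μ) :
    ∫ x, ‖iterAvg L y x + walkTransform L f x‖ ^ p ∂μ ≤
      (p - 1) ^ p * ∫ x, ‖f x‖ ^ p ∂μ +
        p * ((p - 1) / p) ^ (p - 1) * ∫ x, burkholder p (iterAvg L f x) (y x) ∂μ := by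
  have hp0 : 0 < p := by linarith
  induction L generalizing y with
  | nil =>
    simp only [iterAvg_nil, walkTransform_nil, Pi.zero_apply, add_zero]
    rw [← integral_const_mul, ← integral_const_mul, ← integral_add
      ((hf.integrable_norm_rpow_ofReal hp0).const_mul _) ((integrable_burkholder hp hf hy).const_mul _)]
    refine integral_mono (hy.integrable_norm_rpow_ofReal hp0)
      (((hf.integrable_norm_rpow_ofReal hp0).const_mul _).add
        ((integrable_burkholder hp hf hy).const_mul _)) fun x => ?_
    have := norm_rpow_sub_le_burkholder hp (f x) (y x)
    linarith
  | cons s L ih =>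
    obtain ⟨v, ε⟩ := s
    have hε : ‖ε‖ = 1 := hL (v, ε) (by simp)
    have hL' : ∀ s ∈ L, ‖s.2‖ = 1 := fun s hs => hL s (List.mem_cons_of_mem _ hs)
    set F := iterAvg L f with hF
    have hFm : MemLp F _ μ := hf.iterAvg L
    have hPF : MemLp (symAvg v F) _ μ := hFm.symAvg v
    -- the process at the next step, given the position there and the sign of the step
    set yp : G → ℂ := fun w => y (w - v) + ε * (F w - symAvg v F (w - v)) with hyp
    set ym : G → ℂ := fun w => y (w + v) + ε * (F w - symAvg v F (w + v)) with hym
    have hypm : MemLp yp (ENNReal.ofReal p) μ :=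
      (hy.comp_sub_right v).add ((hFm.sub (hPF.comp_sub_right v)).const_mul ε)
    have hymm : MemLp ym (ENNReal.ofReal p) μ :=
      (hy.comp_add_right v).add ((hFm.sub (hPF.comp_add_right v)).const_mul ε)
    -- Conditioning on the sign of the first step gives an average of two shorter walks; convexity
    -- of the `p`-th power then separates them.
    have hsum : ∀ x, iterAvg ((v, ε) :: L) y x + walkTransform ((v, ε) :: L) f x =
        ((iterAvg L yp x + walkTransform L f x) + (iterAvg L ym x + walkTransform L f x)) / 2 := by
      intro x
      have e : yp + ym = (2 : ℂ) • symAvg v y + (2 * ε) • (F - symAvg v (symAvg v F)) := by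
        ext w
        simp only [hyp, hym, Pi.add_apply, Pi.smul_apply, Pi.sub_apply, symAvg_apply v y,
          symAvg_apply v (symAvg v F), smul_eq_mul]
        ring
      have e' := congrFun (congrArg (iterAvg L) e) x
      simp only [map_add, map_smul, Pi.add_apply, Pi.smul_apply, smul_eq_mul] at e'
      rw [walkTransform_cons, iterAvg_cons, symAvg_iterAvg, ← hF]
      simp only [Pi.add_apply, Pi.smul_apply, smul_eq_mul]
      linear_combination -e' / 2
    have hW := hf.walkTransform L
    have ip : Integrable (fun x => ‖iterAvg L yp x + walkTransform L f x‖ ^ p) μ :=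
      ((hypm.iterAvg L).add hW).integrable_norm_rpow_ofReal hp0
    have im : Integrable (fun x => ‖iterAvg L ym x + walkTransform L f x‖ ^ p) μ :=
      ((hymm.iterAvg L).add hW).integrable_norm_rpow_ofReal hp0
    have step1 : ∫ x, ‖iterAvg ((v, ε) :: L) y x + walkTransform ((v, ε) :: L) f x‖ ^ p ∂μ ≤
        (∫ x, ‖iterAvg L yp x + walkTransform L f x‖ ^ p ∂μ +
          ∫ x, ‖iterAvg L ym x + walkTransform L f x‖ ^ p ∂μ) / 2 := by
      rw [← integral_add ip im, ← integral_div]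
      refine integral_mono
        (((hy.iterAvg _).add (hf.walkTransform _)).integrable_norm_rpow_ofReal hp0)
        ((ip.add im).div_const 2) fun x => ?_
      simp only [hsum x]
      exact norm_half_add_rpow_le (by linarith) _ _
    have tp : ∫ w, burkholder p (F w) (yp w) ∂μ =
        ∫ x, burkholder p (F (x + v)) (yp (x + v)) ∂μ :=
      (integral_add_right_eq_self (fun w => burkholder p (F w) (yp w)) v).symm
    have tm : ∫ w, burkholder p (F w) (ym w) ∂μ =
        ∫ x, burkholder p (F (x - v)) (ym (x - v)) ∂μ :=
      (integral_sub_right_eq_self (fun w => burkholder p (F w) (ym w)) v).symm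
    have bp := integrable_burkholder hp (hFm.comp_add_right v) (hypm.comp_add_right v)
    have bm := integrable_burkholder hp (hFm.comp_sub_right v) (hymm.comp_sub_right v)
    have step2 : ∫ w, burkholder p (F w) (yp w) ∂μ + ∫ w, burkholder p (F w) (ym w) ∂μ ≤
        2 * ∫ x, burkholder p (symAvg v F x) (y x) ∂μ := by
      rw [tp, tm, ← integral_add bp bm, ← integral_const_mul]
      refine integral_mono (bp.add bm) ((integrable_burkholder hp hPF hy).const_mul 2) fun x => ?_
      -- After translating to the common starting point `x`, the martingale moves by `±` half the
      -- difference of `F`, and the transform by `ε` times that, with `‖ε‖ = 1`.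
      have h := burkholder_zigzag hp (symAvg v F x) (y x) ((F (x + v) - F (x - v)) / 2)
        (ε * ((F (x + v) - F (x - v)) / 2)) (by rw [norm_mul, hε, one_mul])
      have e1 : symAvg v F x + (F (x + v) - F (x - v)) / 2 = F (x + v) := by
        rw [symAvg_apply]; ring
      have e2 : symAvg v F x - (F (x + v) - F (x - v)) / 2 = F (x - v) := by
        rw [symAvg_apply]; ring
      have e3 : y x + ε * ((F (x + v) - F (x - v)) / 2) = yp (x + v) := by
        simp only [hyp, add_sub_cancel_right]
        rw [symAvg_apply]; ring
      have e4 : y x - ε * ((F (x + v) - F (x - v)) / 2) = ym (x - v) := by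
        simp only [hym, sub_add_cancel]
        rw [symAvg_apply]; ring
      rw [e1, e2, e3, e4] at h
      exact h
    have hα : 0 ≤ p * ((p - 1) / p) ^ (p - 1) := by
      have : 0 ≤ p - 1 := by linarith
      positivity
    have := mul_le_mul_of_nonneg_left step2 hα
    have := ih hL' hypm
    have := ih hL' hymm
    rw [iterAvg_cons (v, ε) L f, ← hF]
    linarith

theorem eLpNorm_walkTransform_le_of_two_le {p : ℝ} (hp : 2 ≤ p) {f : G → ℂ}
    (hf : MemLp f (ENNReal.ofReal p) μ) (L : List (G × ℂ)) (hL : ∀ s ∈ L, ‖s.2‖ = 1) :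
    eLpNorm (walkTransform L f) (ENNReal.ofReal p) μ ≤
      ENNReal.ofReal (p - 1) * eLpNorm f (ENNReal.ofReal p) μ := by
  have hp0 : 0 < p := by linarith
  have hp1 : 0 ≤ p - 1 := by linarith
  have h := integral_walkTransform_le_integral_burkholder hp hf L hL (MemLp.zero (ε := ℂ))
  have h' : ∫ x, ‖walkTransform L f x‖ ^ p ∂μ ≤ (p - 1) ^ p * ∫ x, ‖f x‖ ^ p ∂μ := by
    have h0 : iterAvg L (fun _ => 0 : G → ℂ) = 0 := map_zero _
    simp only [Pi.zero_def] at h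
    simp only [h0, Pi.zero_apply, zero_add] at h
    have : p * ((p - 1) / p) ^ (p - 1) * ∫ x, burkholder p (iterAvg L f x) 0 ∂μ ≤ 0 :=
      mul_nonpos_of_nonneg_of_nonpos (by positivity)
        (integral_nonpos fun x => burkholder_zero_right_nonpos hp _)
    linarith
  have hne : ENNReal.ofReal p ≠ 0 := by simpa using hp0
  rw [hf.eLpNorm_eq_integral_rpow_norm hne ENNReal.ofReal_ne_top,
    (hf.walkTransform L).eLpNorm_eq_integral_rpow_norm hne ENNReal.ofReal_ne_top,
    ENNReal.toReal_ofReal hp0.le, ← ENNReal.ofReal_mul hp1]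
  refine ENNReal.ofReal_le_ofReal ?_
  have hi : 0 ≤ ∫ x, ‖f x‖ ^ p ∂μ := integral_nonneg fun x => by positivity
  calc _ ≤ ((p - 1) ^ p * ∫ x, ‖f x‖ ^ p ∂μ) ^ p⁻¹ := by
        refine Real.rpow_le_rpow (integral_nonneg fun x => by positivity) h' (by positivity)
    _ = _ := by
        rw [Real.mul_rpow (by positivity) hi, Real.rpow_rpow_inv hp1 hp0.ne']

theorem MeasureTheory.MemLp.integrable_fun_mul {G : Type*} [MeasurableSpace G] {μ : Measure G}
    {p q : ℝ≥0∞} [p.HolderTriple q 1] {f g : G → ℂ} (hf : MemLp f p μ) (hg : MemLp g q μ) :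
    Integrable (fun x => f x * g x) μ :=
  hf.integrable_mul hg

theorem integral_symAvg_mul {p q : ℝ≥0∞} [p.HolderTriple q 1] {f g : G → ℂ} (hf : MemLp f p μ)
    (hg : MemLp g q μ) (v : G) :
    ∫ x, symAvg v f x * g x ∂μ = ∫ x, f x * symAvg v g x ∂μ := by
  have i1 : Integrable (fun x => f (x + v) * g x) μ := (hf.comp_add_right v).integrable_fun_mul hg
  have i2 : Integrable (fun x => f (x - v) * g x) μ := (hf.comp_sub_right v).integrable_fun_mul hg
  have i3 : Integrable (fun x => f x * g (x + v)) μ := hf.integrable_fun_mul (hg.comp_add_right v)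
  have i4 : Integrable (fun x => f x * g (x - v)) μ := hf.integrable_fun_mul (hg.comp_sub_right v)
  have e1 : ∫ x, f (x + v) * g x ∂μ = ∫ x, f x * g (x - v) ∂μ := by
    simpa using integral_add_right_eq_self (μ := μ) (fun x => f x * g (x - v)) v
  have e2 : ∫ x, f (x - v) * g x ∂μ = ∫ x, f x * g (x + v) ∂μ := by
    simpa using integral_sub_right_eq_self (μ := μ) (fun x => f x * g (x + v)) v
  calc ∫ x, symAvg v f x * g x ∂μ = ∫ x, (f (x + v) * g x + f (x - v) * g x) / 2 ∂μ := by
        congr with x; rw [symAvg_apply]; ring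
    _ = ∫ x, (f x * g (x + v) + f x * g (x - v)) / 2 ∂μ := by
        rw [integral_div, integral_div, integral_add i1 i2, integral_add i3 i4, e1, e2, add_comm]
    _ = _ := by
        congr with x; rw [symAvg_apply]; ring

theorem integral_iterAvg_mul {p q : ℝ≥0∞} [p.HolderTriple q 1] {f g : G → ℂ} (hf : MemLp f p μ)
    (hg : MemLp g q μ) (L : List (G × ℂ)) :
    ∫ x, iterAvg L f x * g x ∂μ = ∫ x, f x * iterAvg L g x ∂μ := by
  induction L generalizing g with
  | nil => rfl
  | cons s L ih =>
    rw [iterAvg_cons, iterAvg_cons, integral_symAvg_mul (hf.iterAvg L) hg, ih (hg.symAvg _),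
      symAvg_iterAvg]

/-- Each summand is a polynomial in commuting averages `symAvg v`, which are symmetric by
translation invariance. -/
theorem integral_walkTransform_mul {p q : ℝ≥0∞} [p.HolderTriple q 1] {f g : G → ℂ}
    (hf : MemLp f p μ) (hg : MemLp g q μ) (L : List (G × ℂ)) :
    ∫ x, walkTransform L f x * g x ∂μ = ∫ x, f x * walkTransform L g x ∂μ := by
  induction L with
  | nil => simp
  | cons s L ih =>
    have hF := hf.iterAvg L
    have hg' := hg.iterAvg L
    have hF2 := (hF.symAvg s.1).symAvg s.1
    have hg2 := (hg'.symAvg s.1).symAvg s.1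
    have key : ∫ x, iterAvg L (iterAvg L f - symAvg s.1 (symAvg s.1 (iterAvg L f))) x * g x ∂μ =
        ∫ x, f x * iterAvg L (iterAvg L g - symAvg s.1 (symAvg s.1 (iterAvg L g))) x ∂μ := by
      rw [integral_iterAvg_mul (hF.sub hF2) hg, ← integral_iterAvg_mul hf (hg'.sub hg2)]
      simp only [Pi.sub_apply, sub_mul, mul_sub]
      rw [integral_sub (hF.integrable_fun_mul hg') (hF2.integrable_fun_mul hg'),
        integral_sub (hF.integrable_fun_mul hg') (hF.integrable_fun_mul hg2),
        integral_symAvg_mul (hF.symAvg _) hg', integral_symAvg_mul hF (hg'.symAvg _)]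
    have h1 := (hF.sub hF2).iterAvg L
    have h2 := (hg'.sub hg2).iterAvg L
    simp only [walkTransform_cons, Pi.add_apply, Pi.smul_apply, smul_eq_mul, add_mul, mul_add]
    have i1 : Integrable (fun x => s.2 *
        iterAvg L (iterAvg L f - symAvg s.1 (symAvg s.1 (iterAvg L f))) x * g x) μ := by
      simpa only [mul_assoc] using (h1.integrable_fun_mul hg).const_mul s.2
    have i2 : Integrable (fun x => f x * (s.2 *
        iterAvg L (iterAvg L g - symAvg s.1 (symAvg s.1 (iterAvg L g))) x)) μ := by
      simpa only [mul_left_comm] using (hf.integrable_fun_mul h2).const_mul s.2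
    rw [integral_add ((hf.walkTransform L).integrable_fun_mul hg) i1,
      integral_add (hf.integrable_fun_mul (hg.walkTransform L)) i2, ih]
    congr 1
    simp only [mul_assoc, mul_left_comm _ s.2]
    rw [integral_const_mul, integral_const_mul, key]

theorem eLpNorm_walkTransform_le {p : ℝ} (hp : 1 < p) {f : G → ℂ}
    (hf : MemLp f (ENNReal.ofReal p) μ) (L : List (G × ℂ)) (hL : ∀ s ∈ L, ‖s.2‖ = 1) :
    eLpNorm (walkTransform L f) (ENNReal.ofReal p) μ ≤
      ENNReal.ofReal (max p (p / (p - 1)) - 1) * eLpNorm f (ENNReal.ofReal p) μ := by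
  have hp1 : 0 < p - 1 := by linarith
  have hp0 : 0 < p := by linarith
  rcases le_total 2 p with h2 | h2
  · refine (eLpNorm_walkTransform_le_of_two_le h2 hf L hL).trans ?_
    gcongr
    exact le_max_left _ _
  set q := p / (p - 1) with hq
  have hq2 : 2 ≤ q := by rw [hq, le_div_iff₀ hp1]; linarith
  have hpq : p.HolderConjugate q := Real.HolderConjugate.conjExponent hp
  have hc : (ENNReal.ofReal p).HolderTriple (ENNReal.ofReal q) 1 := hpq.ennrealOfReal
  set h := walkTransform L f with hh
  have hm : MemLp h (ENNReal.ofReal p) μ := hf.walkTransform L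
  -- The extremal function in Hölder's inequality: `h * g = ‖h‖ ^ p`, and the `L^q` norm of `g` is
  -- the `L^p` norm of `h` to the power `p - 1`.
  set g : G → ℂ := fun x => conj (h x) * ((‖h x‖ ^ (p - 2) : ℝ) : ℂ) with hg
  have hgn : ∀ x, ‖g x‖ = ‖h x‖ ^ (p - 1) := by
    intro x
    rw [hg]
    simp only [norm_mul, RCLike.norm_conj, Complex.norm_real]
    rw [Real.norm_of_nonneg (by positivity)]
    rcases (norm_nonneg (h x)).eq_or_lt with h0 | h0
    · rw [← h0, zero_mul, Real.zero_rpow hp1.ne']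
    · rw [mul_comm, ← Real.rpow_add_one h0.ne']; ring_nf
  have hgm : eLpNorm g (ENNReal.ofReal q) μ = eLpNorm h (ENNReal.ofReal p) μ ^ (p - 1) := by
    have e : eLpNorm g (ENNReal.ofReal q) μ =
        eLpNorm (fun x => ‖h x‖ ^ (p - 1)) (ENNReal.ofReal q) μ :=
      eLpNorm_congr_norm_ae (.of_forall fun x => by
        rw [hgn, Real.norm_of_nonneg (by positivity)])
    rw [e, eLpNorm_norm_rpow _ hp1, ← ENNReal.ofReal_mul (by linarith), hq,
      div_mul_cancel₀ _ hp1.ne']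
  have hgmem : MemLp g (ENNReal.ofReal q) μ := by
    refine ⟨?_, ?_⟩
    · refine (Complex.continuous_conj.comp_aestronglyMeasurable hm.1).mul ?_
      exact (Complex.measurable_ofReal.comp_aemeasurable
        (hm.1.norm.aemeasurable.pow_const (p - 2))).aestronglyMeasurable
    · rw [hgm]
      exact ENNReal.rpow_lt_top_of_nonneg hp1.le hm.2.ne
  have hmul : ∀ x, h x * g x = ((‖h x‖ ^ p : ℝ) : ℂ) := by
    intro x
    rw [hg]
    simp only
    rw [← mul_assoc, Complex.mul_conj, ← Complex.ofReal_mul, Complex.normSq_eq_norm_sq]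
    congr 1
    rcases (norm_nonneg (h x)).eq_or_lt with h0 | h0
    · rw [← h0, Real.zero_rpow hp0.ne']; simp
    · rw [mul_comm, ← Real.rpow_natCast, ← Real.rpow_add h0]; norm_num
  have hne : ENNReal.ofReal p ≠ 0 := by simpa using hp0
  set I := ∫ x, ‖h x‖ ^ p ∂μ with hI
  have hI0 : 0 ≤ I := integral_nonneg fun x => by positivity
  have hIe : ENNReal.ofReal I = eLpNorm h (ENNReal.ofReal p) μ ^ p := by
    rw [hm.eLpNorm_eq_integral_rpow_norm hne ENNReal.ofReal_ne_top, ENNReal.toReal_ofReal hp0.le,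
      ENNReal.ofReal_rpow_of_nonneg (by positivity) hp0.le, Real.rpow_inv_rpow hI0 hp0.ne']
  have hIf : ENNReal.ofReal I ≤ eLpNorm f (ENNReal.ofReal p) μ *
      (ENNReal.ofReal (q - 1) * eLpNorm h (ENNReal.ofReal p) μ ^ (p - 1)) := by
    have hpair := integral_walkTransform_mul hf hgmem L
    rw [← hh] at hpair
    simp only [hmul] at hpair
    rw [integral_complex_ofReal] at hpair
    have hnorm : ENNReal.ofReal I = ‖∫ x, f x * walkTransform L g x ∂μ‖ₑ := by
      rw [← hpair, ← hI, ← ofReal_norm, Complex.norm_real, Real.norm_of_nonneg hI0]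
    rw [hnorm, ← hgm]
    calc _ ≤ eLpNorm (f • walkTransform L g) 1 μ := by
          rw [eLpNorm_one_eq_lintegral_enorm]
          exact enorm_integral_le_lintegral_enorm _
      _ ≤ eLpNorm f (ENNReal.ofReal p) μ * eLpNorm (walkTransform L g) (ENNReal.ofReal q) μ :=
          eLpNorm_smul_le_mul_eLpNorm (hgmem.walkTransform L).1 hf.1
      _ ≤ _ := by
          gcongr
          exact eLpNorm_walkTransform_le_of_two_le hq2 hgmem L hL
  rcases eq_or_ne (eLpNorm h (ENNReal.ofReal p) μ) 0 with h0 | h0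
  · rw [h0]; exact zero_le
  rw [hIe] at hIf
  have hmax : max p q = q := max_eq_right (by linarith)
  rw [hmax]
  set H := eLpNorm h (ENNReal.ofReal p) μ with hH
  have hHtop : H ≠ ⊤ := hm.2.ne
  have hHp : H ^ p = H * H ^ (p - 1) := by
    conv_lhs => rw [← add_sub_cancel 1 p, ENNReal.rpow_add _ _ h0 hHtop, ENNReal.rpow_one]
  rw [hHp, mul_left_comm, ← mul_assoc] at hIf
  exact (ENNReal.mul_le_mul_iff_left (ENNReal.rpow_pos (pos_iff_ne_zero.2 h0) hHtop).ne'
    (ENNReal.rpow_ne_top_of_nonneg hp1.le hHtop)).1 hIf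

end Walk

/-! ### Fourier symbols of walk transforms. -/

section Symbol

open SchwartzMap Filter Topology RealInnerProductSpace NNReal

/-- The symbol of `iterAvg L`. -/
noncomputable def iterSymbol {V : Type*} [NormedAddCommGroup V] [InnerProductSpace ℝ V]
    (ξ : V) : List (V × ℂ) → ℝ
  | [] => 1
  | s :: L => Real.cos (2 * Real.pi * ⟪s.1, ξ⟫) * iterSymbol ξ L

/-- The symbol of `walkTransform L`. -/
noncomputable def walkSymbol {V : Type*} [NormedAddCommGroup V] [InnerProductSpace ℝ V]
    (ξ : V) : List (V × ℂ) → ℂ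
  | [] => 0
  | s :: L => walkSymbol ξ L +
      s.2 * ((iterSymbol ξ L ^ 2 * (1 - Real.cos (2 * Real.pi * ⟪s.1, ξ⟫) ^ 2) : ℝ) : ℂ)

/-- The moduli of the summands telescope: the one added by `s` is `iterSymbol ξ L ^ 2 - iterSymbol ξ
(s :: L) ^ 2`. -/
theorem norm_walkSymbol_le {V : Type*} [NormedAddCommGroup V]
    [InnerProductSpace ℝ V] (ξ : V) (L : List (V × ℂ)) (hL : ∀ s ∈ L, ‖s.2‖ = 1) :
    ‖walkSymbol ξ L‖ ≤ 1 - iterSymbol ξ L ^ 2 := by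
  induction L with
  | nil => simp [walkSymbol, iterSymbol]
  | cons s L ih =>
    have h := ih fun s hs => hL s (List.mem_cons_of_mem _ hs)
    have h1 : 0 ≤ 1 - Real.cos (2 * Real.pi * ⟪s.1, ξ⟫) ^ 2 := by
      linarith [Real.cos_sq_le_one (2 * Real.pi * ⟪s.1, ξ⟫)]
    rw [walkSymbol, iterSymbol]
    refine (norm_add_le _ _).trans ?_
    rw [norm_mul, hL s (by simp), Complex.norm_real, Real.norm_of_nonneg (by positivity)]
    linarith

theorem norm_walkSymbol_le_one {V : Type*} [NormedAddCommGroup V]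
    [InnerProductSpace ℝ V] (ξ : V) (L : List (V × ℂ)) (hL : ∀ s ∈ L, ‖s.2‖ = 1) :
    ‖walkSymbol ξ L‖ ≤ 1 := by
  linarith [norm_walkSymbol_le ξ L hL, sq_nonneg (iterSymbol ξ L)]

variable {V : Type*} [NormedAddCommGroup V] [InnerProductSpace ℝ V] [FiniteDimensional ℝ V]
  [MeasurableSpace V] [BorelSpace V]

/-- The Fourier transform of `g` is `σ` times that of `f`. -/
def HasSymbol (f : Lp ℂ 2 (volume : Measure V)) (g : V → ℂ) (σ : V → ℂ) : Prop :=
  ∃ hg : MemLp g 2, (𝓕 (hg.toLp g) : Lp ℂ 2 (volume : Measure V)) =ᵐ[volume] fun ξ => σ ξ * 𝓕 f ξ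

theorem memLp_top_fourierChar_inner (a : V) :
    MemLp (fun ξ : V => (Real.fourierChar ⟪a, ξ⟫ : ℂ)) ∞ volume := by
  refine memLp_top_of_bound (Continuous.aestronglyMeasurable ?_) 1
    (.of_forall fun ξ => (Circle.norm_coe _).le)
  exact continuous_subtype_val.comp (Real.continuous_fourierChar.comp (by fun_prop))

theorem SchwartzMap.fourier_compSubConstCLM (f : 𝓢(V, ℂ)) (a : V) (ξ : V) :
    𝓕 (f.compSubConstCLM ℂ a) ξ = (Real.fourierChar ⟪-a, ξ⟫ : ℂ) * 𝓕 f ξ := by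
  have h := congrFun (VectorFourier.fourierIntegral_comp_add_right Real.fourierChar volume
    (innerₗ V) f (-a)) ξ
  have e : (f : V → ℂ) ∘ (fun v => v + -a) = f.compSubConstCLM ℂ a := by
    ext x
    simp [sub_eq_add_neg]
  rw [e] at h
  exact h

/-- Both sides are continuous in `f`, so the identity for Schwartz functions suffices. -/
theorem fourier_compMeasurePreserving_add_right (a : V) (f : Lp ℂ 2 (volume : Measure V)) :
    𝓕 (Lp.compMeasurePreserving (fun x => x + a) (measurePreserving_add_right volume a) f) =
      (ContinuousLinearMap.mul ℂ ℂ).holderL volume ∞ 2 2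
        ((memLp_top_fourierChar_inner a).toLp _) (𝓕 f) := by
  refine DenseRange.induction_on (p := fun f : Lp ℂ 2 (volume : Measure V) =>
    𝓕 (Lp.compMeasurePreserving (fun x => x + a) (measurePreserving_add_right volume a) f) =
      (ContinuousLinearMap.mul ℂ ℂ).holderL volume ∞ 2 2
        ((memLp_top_fourierChar_inner a).toLp _) (𝓕 f))
    (SchwartzMap.denseRange_toLpCLM (p := 2) ENNReal.ofNat_ne_top) f ?_ fun g => ?_
  · refine isClosed_eq ?_ ?_
    · exact (Lp.fourierTransformₗᵢ V ℂ).continuous.comp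
        (Lp.compMeasurePreservingₗᵢ ℂ _ (measurePreserving_add_right volume a)).continuous
    · exact (ContinuousLinearMap.continuous _).comp (Lp.fourierTransformₗᵢ V ℂ).continuous
  · rw [SchwartzMap.toLpCLM_apply]
    have e : Lp.compMeasurePreserving (fun x => x + a) (measurePreserving_add_right volume a)
        (g.toLp 2) = (g.compSubConstCLM ℂ (-a)).toLp 2 := by
      apply Lp.ext
      refine (Lp.coeFn_compMeasurePreserving _ _).trans ?_
      refine ((measurePreserving_add_right volume a).quasiMeasurePreserving.ae_eq_comp
        (g.coeFn_toLp 2 volume)).trans ?_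
      refine .trans (.of_eq ?_) (SchwartzMap.coeFn_toLp _ 2 volume).symm
      ext x
      simp
    rw [e, SchwartzMap.toLp_fourier_eq, SchwartzMap.toLp_fourier_eq]
    apply Lp.ext
    rw [ContinuousLinearMap.holderL_apply_apply]
    filter_upwards [SchwartzMap.coeFn_toLp (𝓕 (g.compSubConstCLM ℂ (-a))) 2 volume,
      SchwartzMap.coeFn_toLp (𝓕 g) 2 volume,
      (ContinuousLinearMap.mul ℂ ℂ).coeFn_holder (r := 2)
        ((memLp_top_fourierChar_inner a).toLp _) ((𝓕 g).toLp 2),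
      (memLp_top_fourierChar_inner a).coeFn_toLp] with ξ h1 h2 h3 h4
    rw [h1, h3, h4, h2, SchwartzMap.fourier_compSubConstCLM, neg_neg]
    rfl

namespace HasSymbol

variable {f : Lp ℂ 2 (volume : Measure V)} {g g' : V → ℂ} {σ σ' : V → ℂ}

theorem self (f : Lp ℂ 2 (volume : Measure V)) : HasSymbol f f 1 :=
  ⟨Lp.memLp f, by simp⟩

theorem zero (f : Lp ℂ 2 (volume : Measure V)) : HasSymbol f 0 0 := by
  refine ⟨MemLp.zero, ?_⟩
  have e : 𝓕 ((MemLp.zero : MemLp (0 : V → ℂ) 2 volume).toLp 0) = 0 := by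
    rw [MemLp.toLp_zero]
    exact map_zero (Lp.fourierTransformₗᵢ V ℂ)
  rw [e]
  filter_upwards [Lp.coeFn_zero ℂ 2 (volume : Measure V)] with ξ hξ
  rw [hξ]; simp

theorem add (h : HasSymbol f g σ) (h' : HasSymbol f g' σ') : HasSymbol f (g + g') (σ + σ') := by
  obtain ⟨hg, e⟩ := h
  obtain ⟨hg', e'⟩ := h'
  refine ⟨hg.add hg', ?_⟩
  rw [MemLp.toLp_add hg hg', FourierTransform.fourier_add]
  filter_upwards [e, e', Lp.coeFn_add (𝓕 (hg.toLp g)) (𝓕 (hg'.toLp g'))] with ξ h1 h2 h3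
  rw [h3, Pi.add_apply, h1, h2, Pi.add_apply, add_mul]

theorem const_smul (h : HasSymbol f g σ) (c : ℂ) : HasSymbol f (c • g) (c • σ) := by
  obtain ⟨hg, e⟩ := h
  refine ⟨hg.const_smul c, ?_⟩
  rw [MemLp.toLp_const_smul c hg, FourierTransform.fourier_smul]
  filter_upwards [e, Lp.coeFn_smul c (𝓕 (hg.toLp g))] with ξ h1 h2
  rw [h2, Pi.smul_apply, h1, Pi.smul_apply, smul_eq_mul, smul_eq_mul, mul_assoc]

theorem sub (h : HasSymbol f g σ) (h' : HasSymbol f g' σ') : HasSymbol f (g - g') (σ - σ') := by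
  simpa [sub_eq_add_neg] using h.add (h'.const_smul (-1))

theorem comp_add_right (h : HasSymbol f g σ) (a : V) :
    HasSymbol f (fun x => g (x + a)) fun ξ => Real.fourierChar ⟪a, ξ⟫ * σ ξ := by
  obtain ⟨hg, e⟩ := h
  refine ⟨hg.comp_add_right a, ?_⟩
  have e1 : (hg.comp_add_right a).toLp (fun x => g (x + a)) =
      Lp.compMeasurePreserving (fun x => x + a) (measurePreserving_add_right volume a)
        (hg.toLp g) :=
    (Lp.toLp_compMeasurePreserving hg (measurePreserving_add_right volume a)).symm
  rw [e1, fourier_compMeasurePreserving_add_right, ContinuousLinearMap.holderL_apply_apply]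
  filter_upwards [e, (ContinuousLinearMap.mul ℂ ℂ).coeFn_holder (r := 2)
      ((memLp_top_fourierChar_inner a).toLp _) (𝓕 (hg.toLp g)),
    (memLp_top_fourierChar_inner a).coeFn_toLp] with ξ h1 h2 h3
  rw [h2, h3, h1, ContinuousLinearMap.mul_apply', mul_assoc]

theorem congr_symbol (h : HasSymbol f g σ) (e : ∀ ξ, σ ξ = σ' ξ) : HasSymbol f g σ' :=
  funext e ▸ h

theorem symAvg (h : HasSymbol f g σ) (v : V) :
    HasSymbol f (symAvg v g) fun ξ => (Real.cos (2 * Real.pi * ⟪v, ξ⟫) : ℂ) * σ ξ := by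
  have h1 := ((h.comp_add_right v).add (h.comp_add_right (-v))).const_smul (2⁻¹ : ℂ)
  have e : _root_.symAvg v g = (2⁻¹ : ℂ) • ((fun x => g (x + v)) + fun x => g (x + -v)) := by
    ext x
    simp [symAvg_apply, sub_eq_add_neg, div_eq_inv_mul]
  rw [e]
  refine h1.congr_symbol fun ξ => ?_
  simp only [Pi.smul_apply, Pi.add_apply, Real.fourierChar_apply, inner_neg_left, smul_eq_mul,
    Complex.ofReal_cos, Complex.cos]
  push_cast
  ring_nf

end HasSymbol

variable {f : Lp ℂ 2 (volume : Measure V)} {g : V → ℂ} {σ : V → ℂ}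

theorem HasSymbol.iterAvg (h : HasSymbol f g σ) (L : List (V × ℂ)) :
    HasSymbol f (iterAvg L g) fun ξ => (iterSymbol ξ L : ℂ) * σ ξ := by
  induction L with
  | nil => exact h.congr_symbol fun ξ => by simp [iterSymbol]
  | cons s L ih =>
    exact (ih.symAvg s.1).congr_symbol fun ξ => by
      simp only [iterSymbol]; push_cast; ring

theorem hasSymbol_walkTransform (f : Lp ℂ 2 (volume : Measure V)) (L : List (V × ℂ)) :
    HasSymbol f (walkTransform L f) fun ξ => walkSymbol ξ L := by
  induction L with
  | nil => exact HasSymbol.zero f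
  | cons s L ih =>
    have h := (HasSymbol.self f).iterAvg L
    exact (ih.add (((h.sub ((h.symAvg s.1).symAvg s.1)).iterAvg L).const_smul s.2)).congr_symbol
      fun ξ => by
        simp only [walkSymbol, Pi.add_apply, Pi.sub_apply, Pi.smul_apply, smul_eq_mul,
          Pi.one_apply, mul_one]
        push_cast
        ring

/-- `L^p` bounds pass to Fourier multipliers whose symbol is a bounded pointwise limit. -/
theorem HasSymbol.eLpNorm_le_of_tendsto {σs : ℕ → V → ℂ} {gs : ℕ → V → ℂ} {p C : ℝ≥0∞} {K : ℝ≥0}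
    (h : HasSymbol f g σ) (hs : ∀ n, HasSymbol f (gs n) (σs n)) (hσs : ∀ n ξ, ‖σs n ξ‖₊ ≤ K)
    (hlim : ∀ᵐ ξ, Tendsto (fun n => σs n ξ) atTop (𝓝 (σ ξ)))
    (hC : ∀ n, eLpNorm (gs n) p volume ≤ C) : eLpNorm g p volume ≤ C := by
  obtain ⟨hg, e⟩ := h
  choose hgs es using hs
  set F := 𝓕 f with hF
  -- By Plancherel and dominated convergence `gs n` tends to `g` in `L²`, hence in measure, and the
  -- `L^p` norm is lower semicontinuous under convergence in measure.
  have hd : ∀ n, ‖(hgs n).toLp (gs n) - hg.toLp g‖ₑ =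
      (∫⁻ ξ, ‖(σs n ξ - σ ξ) * F ξ‖ₑ ^ (2 : ℝ)) ^ (1 / 2 : ℝ) := by
    intro n
    rw [← (Lp.fourierTransformₗᵢ V ℂ).enorm_map, map_sub, Lp.enorm_def,
      eLpNorm_eq_lintegral_rpow_enorm_toReal (by simp) (by simp), ENNReal.toReal_ofNat]
    congr 1
    refine lintegral_congr_ae ?_
    filter_upwards [e, es n, Lp.coeFn_sub (𝓕 ((hgs n).toLp (gs n))) (𝓕 (hg.toLp g))]
      with ξ h1 h2 h3
    have h3' : (Lp.fourierTransformₗᵢ V ℂ ((hgs n).toLp (gs n)) -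
      Lp.fourierTransformₗᵢ V ℂ (hg.toLp g) : Lp ℂ 2 (volume : Measure V)) ξ = _ := h3
    rw [h3', Pi.sub_apply, h1, h2, sub_mul]
  have hσ : ∀ᵐ ξ, ‖σ ξ‖₊ ≤ K := by
    filter_upwards [hlim] with ξ hξ
    exact le_of_tendsto hξ.nnnorm (.of_forall fun n => hσs n ξ)
  have hlint : Tendsto (fun n => ∫⁻ ξ, ‖(σs n ξ - σ ξ) * F ξ‖ₑ ^ (2 : ℝ)) atTop (𝓝 0) := by
    rw [← lintegral_zero (α := V) (μ := volume)]
    refine tendsto_lintegral_of_dominated_convergence' (fun ξ => ((K + K) * ‖F ξ‖ₑ) ^ (2 : ℝ))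
      (fun n => ?_) (fun n => ?_) ?_ ?_
    · have hm : AEMeasurable (fun ξ => (σs n ξ - σ ξ) * F ξ) volume := by
        have h1 := (Lp.aestronglyMeasurable (𝓕 ((hgs n).toLp (gs n)))).congr (es n)
        have h2 := (Lp.aestronglyMeasurable (𝓕 (hg.toLp g))).congr e
        simpa only [sub_mul] using! (h1.sub h2).aemeasurable
      exact hm.enorm.pow_const _
    · filter_upwards [hσ] with ξ hξ
      rw [enorm_mul]
      gcongr
      calc ‖σs n ξ - σ ξ‖ₑ ≤ ‖σs n ξ‖ₑ + ‖σ ξ‖ₑ := enorm_sub_le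
        _ ≤ K + K := by
          gcongr
          · exact enorm_le_coe.2 (hσs n ξ)
          · exact enorm_le_coe.2 hξ
    · have := (Lp.memLp F).2
      rw [eLpNorm_eq_lintegral_rpow_enorm_toReal (by simp) (by simp), ENNReal.toReal_ofNat] at this
      simp only [ENNReal.mul_rpow_of_nonneg _ _ (zero_le_two (α := ℝ))]
      rw [lintegral_const_mul' _ _ (by simp)]
      refine ENNReal.mul_ne_top (by simp) ?_
      intro htop
      rw [htop] at this
      simp at this
    · filter_upwards [hlim] with ξ hξ
      have h1 : Tendsto (fun n => ‖(σs n ξ - σ ξ) * F ξ‖ₑ ^ (2 : ℝ)) atTop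
          (𝓝 (‖(σ ξ - σ ξ) * F ξ‖ₑ ^ (2 : ℝ))) :=
        ((ENNReal.continuous_rpow_const.comp continuous_enorm).tendsto _).comp
          ((hξ.sub_const (σ ξ)).mul_const (F ξ))
      simpa using h1
  have htend : Tendsto (fun n => (hgs n).toLp (gs n)) atTop (𝓝 (hg.toLp g)) := by
    rw [tendsto_iff_edist_tendsto_0]
    simp only [edist_eq_enorm_sub, hd]
    have := ((ENNReal.continuous_rpow_const (y := 1 / 2)).tendsto 0).comp hlint
    simpa using! this
  have hmeas : TendstoInMeasure volume gs atTop g :=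
    (tendstoInMeasure_of_tendsto_Lp htend).congr (fun n => (hgs n).coeFn_toLp) hg.coeFn_toLp
  exact eLpNorm_le_of_tendstoInMeasure (.of_forall hC) hmeas fun n => (hgs n).1

end Symbol

/-! ### Limit symbol of the alternating walks. -/

section Limit

open Filter Topology RealInnerProductSpace

/-- `n` rounds of a walk with steps `± v`, `± w` and multipliers `1`, `-1`. -/
def alternatingWalk {V : Type*} (v w : V) : ℕ → List (V × ℂ)
  | 0 => []
  | n + 1 => (v, 1) :: (w, -1) :: alternatingWalk v w n

theorem norm_snd_of_mem_alternatingWalk {V : Type*} (v w : V) (n : ℕ) :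
    ∀ s ∈ alternatingWalk v w n, ‖s.2‖ = 1 := by
  induction n with
  | zero => simp [alternatingWalk]
  | succ n ih =>
    intro s hs
    simp only [alternatingWalk, List.mem_cons] at hs
    rcases hs with rfl | rfl | hs
    · simp
    · simp
    · exact ih s hs

section

variable {V : Type*} [NormedAddCommGroup V] [InnerProductSpace ℝ V]

theorem iterSymbol_alternatingWalk (v w ξ : V) (n : ℕ) :
    iterSymbol ξ (alternatingWalk v w n) =
      (Real.cos (2 * Real.pi * ⟪v, ξ⟫) * Real.cos (2 * Real.pi * ⟪w, ξ⟫)) ^ n := by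
  induction n with
  | zero => simp [alternatingWalk, iterSymbol]
  | succ n ih => simp only [alternatingWalk, iterSymbol, ih]; ring

theorem walkSymbol_alternatingWalk (v w ξ : V) (n : ℕ) :
    walkSymbol ξ (alternatingWalk v w n) =
      (((∑ k ∈ Finset.range n, ((Real.cos (2 * Real.pi * ⟪v, ξ⟫) *
          Real.cos (2 * Real.pi * ⟪w, ξ⟫)) ^ 2) ^ k) *
        (Real.cos (2 * Real.pi * ⟪w, ξ⟫) ^ 2 * Real.sin (2 * Real.pi * ⟪v, ξ⟫) ^ 2 -
          Real.sin (2 * Real.pi * ⟪w, ξ⟫) ^ 2) : ℝ) : ℂ) := by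
  induction n with
  | zero => simp [alternatingWalk, walkSymbol]
  | succ n ih =>
    rw [Finset.sum_range_succ]
    simp only [alternatingWalk, walkSymbol, iterSymbol, ih, iterSymbol_alternatingWalk,
      Real.sin_sq]
    push_cast
    ring

end

theorem tendsto_sin_mul_div (t : ℝ) :
    Tendsto (fun n : ℕ => Real.sin (t * (1 / ((n : ℝ) + 1))) * ((n : ℝ) + 1)) atTop (𝓝 t) := by
  have h1 : HasDerivAt (fun x => Real.sin (t * x)) t 0 := by
    simpa using ((hasDerivAt_id (0 : ℝ)).const_mul t).sin
  have h2 := h1.tendsto_slope_zero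
  have h3 : Tendsto (fun n : ℕ => 1 / ((n : ℝ) + 1)) atTop (𝓝[≠] 0) :=
    tendsto_nhdsWithin_iff.2 ⟨tendsto_one_div_add_atTop_nhds_zero_nat,
      .of_forall fun n => by simpa using Nat.cast_add_one_ne_zero n⟩
  refine (h2.comp h3).congr fun n => ?_
  simp [mul_comm]

/-- A geometric sum with ratio `x n`, where `1 - x n` is of order `(n + 1) ^ (-2)`. Taking `(n + 1)
^ 3` rounds makes the power of `x n` vanish, leaving the quotient of the increment per round by `1 -
x n`. -/
theorem tendsto_alternating_symbol {a b : ℝ} (hab : 0 < a ^ 2 + b ^ 2) :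
    Tendsto (fun n : ℕ =>
      (∑ k ∈ Finset.range ((n + 1) ^ 3), ((Real.cos (a * (1 / ((n : ℝ) + 1))) *
          Real.cos (b * (1 / ((n : ℝ) + 1)))) ^ 2) ^ k) *
        (Real.cos (b * (1 / ((n : ℝ) + 1))) ^ 2 * Real.sin (a * (1 / ((n : ℝ) + 1))) ^ 2 -
          Real.sin (b * (1 / ((n : ℝ) + 1))) ^ 2)) atTop
      (𝓝 ((a ^ 2 - b ^ 2) / (a ^ 2 + b ^ 2))) := by
  set u : ℕ → ℝ := fun n => Real.sin (a * (1 / ((n : ℝ) + 1))) * ((n : ℝ) + 1) with hu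
  set w : ℕ → ℝ := fun n => Real.sin (b * (1 / ((n : ℝ) + 1))) * ((n : ℝ) + 1) with hw
  set c : ℕ → ℝ := fun n => Real.cos (b * (1 / ((n : ℝ) + 1))) with hc
  set x : ℕ → ℝ := fun n => (Real.cos (a * (1 / ((n : ℝ) + 1))) * c n) ^ 2 with hx
  have tu : Tendsto u atTop (𝓝 a) := tendsto_sin_mul_div a
  have tw : Tendsto w atTop (𝓝 b) := tendsto_sin_mul_div b
  have tc : Tendsto c atTop (𝓝 1) := by
    have := (Real.continuous_cos.tendsto _).comp
      ((tendsto_one_div_add_atTop_nhds_zero_nat (𝕜 := ℝ)).const_mul b)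
    rw [mul_zero, Real.cos_zero] at this
    exact this
  have tden : Tendsto (fun n => w n ^ 2 + c n ^ 2 * u n ^ 2) atTop (𝓝 (a ^ 2 + b ^ 2)) := by
    have := (tw.pow 2).add ((tc.pow 2).mul (tu.pow 2))
    simpa [add_comm] using this
  have tnum : Tendsto (fun n => c n ^ 2 * u n ^ 2 - w n ^ 2) atTop (𝓝 (a ^ 2 - b ^ 2)) := by
    have := ((tc.pow 2).mul (tu.pow 2)).sub (tw.pow 2)
    simpa using this
  have hden : ∀ n : ℕ, w n ^ 2 + c n ^ 2 * u n ^ 2 = (1 - x n) * ((n : ℝ) + 1) ^ 2 := by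
    intro n
    simp only [hw, hu, hx, hc, mul_pow, Real.sin_sq]
    ring
  have tx : Tendsto (fun n => x n ^ (n + 1) ^ 3) atTop (𝓝 0) := by
    have texp : Tendsto (fun n : ℕ => Real.exp (-(((n : ℝ) + 1) *
        (w n ^ 2 + c n ^ 2 * u n ^ 2)))) atTop (𝓝 0) := by
      refine Real.tendsto_exp_neg_atTop_nhds_zero.comp (Tendsto.atTop_mul_pos hab ?_ tden)
      exact tendsto_atTop_add_const_right _ _ tendsto_natCast_atTop_atTop
    refine squeeze_zero (fun n => pow_nonneg (sq_nonneg _) _) (fun n => ?_) texp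
    have h1 : x n ≤ Real.exp (-(1 - x n)) := by linarith [Real.add_one_le_exp (-(1 - x n))]
    calc x n ^ (n + 1) ^ 3 ≤ Real.exp (-(1 - x n)) ^ (n + 1) ^ 3 :=
          pow_le_pow_left₀ (sq_nonneg _) h1 _
      _ = _ := by
          rw [← Real.exp_nat_mul, hden]
          push_cast
          ring_nf
  have tmain : Tendsto (fun n => (1 - x n ^ (n + 1) ^ 3) *
      ((c n ^ 2 * u n ^ 2 - w n ^ 2) / (w n ^ 2 + c n ^ 2 * u n ^ 2))) atTop
      (𝓝 ((a ^ 2 - b ^ 2) / (a ^ 2 + b ^ 2))) := by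
    have := (tx.const_sub 1).mul (tnum.div tden hab.ne')
    simpa using this
  refine tmain.congr' ?_
  -- Dividing by `1 - x n` is legitimate only eventually, once the denominator is close to its
  -- positive limit.
  filter_upwards [tden.eventually (lt_mem_nhds hab)] with n hn
  rw [hden] at hn
  rw [← geom_sum_mul_neg, hden]
  have hn1 : ((n : ℝ) + 1) ^ 2 ≠ 0 := by positivity
  have hx1 : 1 - x n ≠ 0 := fun h => by rw [h, zero_mul] at hn; exact hn.false
  have e : c n ^ 2 * u n ^ 2 - w n ^ 2 = (c n ^ 2 * Real.sin (a * (1 / ((n : ℝ) + 1))) ^ 2 -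
      Real.sin (b * (1 / ((n : ℝ) + 1))) ^ 2) * ((n : ℝ) + 1) ^ 2 := by
    simp only [hu, hw]; ring
  rw [e, mul_div_mul_right _ _ hn1, mul_assoc, mul_div_cancel₀ _ hx1]

theorem tendsto_walkSymbol_alternatingWalk {V : Type*} [NormedAddCommGroup V]
    [InnerProductSpace ℝ V] {v w ξ : V} (hξ : 0 < ⟪v, ξ⟫ ^ 2 + ⟪w, ξ⟫ ^ 2) :
    Tendsto (fun n : ℕ => walkSymbol ξ (alternatingWalk ((1 / ((n : ℝ) + 1)) • v)
      ((1 / ((n : ℝ) + 1)) • w) ((n + 1) ^ 3))) atTop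
      (𝓝 (((⟪v, ξ⟫ ^ 2 - ⟪w, ξ⟫ ^ 2) / (⟪v, ξ⟫ ^ 2 + ⟪w, ξ⟫ ^ 2) : ℝ) : ℂ)) := by
  have h2 : 0 < (2 * Real.pi) ^ 2 := by positivity
  have h := tendsto_alternating_symbol (a := 2 * Real.pi * ⟪v, ξ⟫) (b := 2 * Real.pi * ⟪w, ξ⟫)
    (by rw [mul_pow (2 * Real.pi), mul_pow (2 * Real.pi), ← mul_add]; exact mul_pos h2 hξ)
  rw [mul_pow (2 * Real.pi), mul_pow (2 * Real.pi), ← mul_add, ← mul_sub,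
    mul_div_mul_left _ _ h2.ne'] at h
  refine ((Complex.continuous_ofReal.tendsto _).comp h).congr fun n => ?_
  rw [walkSymbol_alternatingWalk]
  simp only [Function.comp_apply, real_inner_smul_left]
  rw [show ∀ t s : ℝ, 2 * Real.pi * (s * t) = 2 * Real.pi * t * s from fun t s => by ring,
    show ∀ t s : ℝ, 2 * Real.pi * (s * t) = 2 * Real.pi * t * s from fun t s => by ring]

end Limit

/-! ### Multiplier operators and extension from `L² ∩ L^q` to `L^q`. -/

section Multiplier

theorem HasSymbol.congr_ae {V : Type*} [NormedAddCommGroup V] [InnerProductSpace ℝ V]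
    [FiniteDimensional ℝ V] [MeasurableSpace V] [BorelSpace V] {f : Lp ℂ 2 (volume : Measure V)}
    {g g' : V → ℂ} {σ : V → ℂ} (h : HasSymbol f g σ) (e : g =ᵐ[volume] g') : HasSymbol f g' σ := by
  obtain ⟨hg, hσ⟩ := h
  refine ⟨(memLp_congr_ae e).1 hg, ?_⟩
  rwa [← MemLp.toLp_congr hg _ e]

theorem HasSymbol.trans {V : Type*} [NormedAddCommGroup V] [InnerProductSpace ℝ V]
    [FiniteDimensional ℝ V] [MeasurableSpace V] [BorelSpace V]
    {f g : Lp ℂ 2 (volume : Measure V)} {k : V → ℂ} {σ τ : V → ℂ} (h : HasSymbol f g σ)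
    (h' : HasSymbol g k τ) : HasSymbol f k fun ξ => τ ξ * σ ξ := by
  obtain ⟨hg, hσ⟩ := h
  obtain ⟨hk, hτ⟩ := h'
  rw [Lp.toLp_coeFn] at hσ
  refine ⟨hk, ?_⟩
  filter_upwards [hσ, hτ] with ξ h1 h2
  rw [h2, h1, mul_assoc]

theorem hasSymbol_multiplierOp (m : Plane → ℂ) (hm : MemLp m ∞ (volume : Measure Plane))
    (f : Lp ℂ 2 (volume : Measure Plane)) : HasSymbol f (multiplierOp m hm f) m := by
  refine ⟨Lp.memLp _, ?_⟩
  rw [Lp.toLp_coeFn]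
  have e : 𝓕 (multiplierOp m hm f) =
      (ContinuousLinearMap.mul ℂ ℂ).holder 2 (hm.toLp m) (𝓕 f) :=
    (Lp.fourierTransformₗᵢ Plane ℂ).apply_symm_apply _
  rw [e]
  filter_upwards [(ContinuousLinearMap.mul ℂ ℂ).coeFn_holder (r := 2) (hm.toLp m) (𝓕 f),
    hm.coeFn_toLp] with ξ h1 h2
  rw [h1, h2]
  rfl

/-- The functions in `L² ∩ L^q`, represented by their classes in both spaces. -/
def lpIntersection (q : ℝ≥0∞) [Fact (1 ≤ q)] :
    Submodule ℂ (Lp ℂ 2 (volume : Measure Plane) × Lp ℂ q (volume : Measure Plane)) where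
  carrier := {z | z.1 =ᵐ[volume] z.2}
  add_mem' := fun {y z} (hy : y.1 =ᵐ[volume] y.2) (hz : z.1 =ᵐ[volume] z.2) =>
    (Lp.coeFn_add y.1 z.1).trans ((hy.add hz).trans (Lp.coeFn_add y.2 z.2).symm)
  zero_mem' := (Lp.coeFn_zero _ _ _).trans (Lp.coeFn_zero _ _ _).symm
  smul_mem' := fun c z (hz : z.1 =ᵐ[volume] z.2) =>
    (Lp.coeFn_smul c z.1).trans ((hz.const_smul c).trans (Lp.coeFn_smul c z.2).symm)

theorem mem_lpIntersection {q : ℝ≥0∞} [Fact (1 ≤ q)]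
    {z : Lp ℂ 2 (volume : Measure Plane) × Lp ℂ q (volume : Measure Plane)} :
    z ∈ lpIntersection q ↔ z.1 =ᵐ[volume] z.2 := Iff.rfl

theorem denseRange_snd_lpIntersection {q : ℝ≥0∞} [Fact (1 ≤ q)] (hq : q ≠ ∞) :
    DenseRange (LinearMap.snd ℂ _ _ ∘ₗ (lpIntersection q).subtype) := by
  refine (SchwartzMap.denseRange_toLpCLM (p := q) hq).mono ?_
  rintro _ ⟨s, rfl⟩
  exact ⟨⟨(s.toLp 2, s.toLp q), mem_lpIntersection.2
    ((s.coeFn_toLp 2 volume).trans (s.coeFn_toLp q volume).symm)⟩, rfl⟩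

theorem exists_linearMap_lpIntersection {q : ℝ≥0∞} [Fact (1 ≤ q)]
    {S : Lp ℂ 2 (volume : Measure Plane) →L[ℂ] Lp ℂ 2 (volume : Measure Plane)}
    (hS : ∀ z : lpIntersection q, MemLp (S z.1.1) q volume) :
    ∃ φ : lpIntersection q →ₗ[ℂ] Lp ℂ q (volume : Measure Plane),
      ∀ z, φ z =ᵐ[volume] S z.1.1 := by
  have hadd : ∀ y z : lpIntersection q,
      (hS (y + z)).toLp _ = (hS y).toLp _ + (hS z).toLp _ := by
    intro y z
    rw [← MemLp.toLp_add (hS y) (hS z)]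
    refine MemLp.toLp_congr _ _ ?_
    have e : S (y + z).1.1 = S y.1.1 + S z.1.1 := S.map_add y.1.1 z.1.1
    rw [e]
    exact Lp.coeFn_add _ _
  have hsmul : ∀ (c : ℂ) (z : lpIntersection q), (hS (c • z)).toLp _ = c • (hS z).toLp _ := by
    intro c z
    rw [← MemLp.toLp_const_smul c (hS z)]
    refine MemLp.toLp_congr _ _ ?_
    have e : S (c • z).1.1 = c • S z.1.1 := S.map_smul c z.1.1
    rw [e]
    exact Lp.coeFn_smul _ _
  exact ⟨{ toFun := fun z => (hS z).toLp _, map_add' := hadd, map_smul' := hsmul },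
    fun z => (hS z).coeFn_toLp⟩

/-- Schwartz functions lie in `L² ∩ L^q` and are dense in `L^q`, so the bounded map on the
intersection extends by continuity, and in only one way. -/
theorem lpNormLE_of_eLpNorm_le {q : ℝ≥0∞} [Fact (1 ≤ q)] (hq : q ≠ ∞)
    {S : Lp ℂ 2 (volume : Measure Plane) →L[ℂ] Lp ℂ 2 (volume : Measure Plane)} {C : ℝ}
    (hC : 0 ≤ C) (h : ∀ f : Lp ℂ 2 (volume : Measure Plane), MemLp f q volume →
      eLpNorm (S f) q volume ≤ ENNReal.ofReal C * eLpNorm f q volume) : LpNormLE q S C := by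
  have hW : ∀ z : lpIntersection q,
      eLpNorm (S z.1.1) q volume ≤ ENNReal.ofReal C * eLpNorm z.1.2 q volume := by
    intro z
    have hz := mem_lpIntersection.1 z.2
    rw [← eLpNorm_congr_ae hz]
    exact h _ ((memLp_congr_ae hz).2 (Lp.memLp _))
  obtain ⟨φ, hφ⟩ := exists_linearMap_lpIntersection (q := q) (S := S) fun z =>
    ⟨Lp.aestronglyMeasurable _, (hW z).trans_lt
      (ENNReal.mul_lt_top ENNReal.ofReal_lt_top (Lp.memLp z.1.2).2)⟩
  have hdense := denseRange_snd_lpIntersection hq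
  have hbound : ∀ z, ‖φ z‖ ≤ C * ‖(LinearMap.snd ℂ _ _ ∘ₗ (lpIntersection q).subtype) z‖ := by
    intro z
    have hz : ‖φ z‖ₑ ≤ ENNReal.ofReal C * ‖z.1.2‖ₑ := by
      rw [Lp.enorm_def, Lp.enorm_def, eLpNorm_congr_ae (hφ z)]
      exact hW z
    rw [← ofReal_norm, ← ofReal_norm, ← ENNReal.ofReal_mul hC,
      ENNReal.ofReal_le_ofReal_iff (mul_nonneg hC (norm_nonneg _))] at hz
    exact hz
  refine ⟨φ.extendOfNorm _, fun A' => ⟨fun hA' => ?_, ?_⟩,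
    LinearMap.opNorm_extendOfNorm_le hdense hC hbound⟩
  · refine (LinearMap.extendOfNorm_unique hdense C hbound A' (LinearMap.ext fun z => ?_)).symm
    exact Lp.ext ((hA' _ _ (mem_lpIntersection.1 z.2)).symm.trans (hφ z).symm)
  · rintro rfl f g hfg
    have hg := LinearMap.extendOfNorm_eq hdense ⟨C, hbound⟩
      (⟨(f, g), mem_lpIntersection.2 hfg⟩ : lpIntersection q)
    have hg' : φ.extendOfNorm _ g = φ ⟨(f, g), mem_lpIntersection.2 hfg⟩ := hg
    rw [hg']
    exact (hφ ⟨(f, g), mem_lpIntersection.2 hfg⟩).symm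

end Multiplier

/-! ### The two operators of the theorem. -/

section Plane

open Filter Topology RealInnerProductSpace

/-- The transform along an alternating walk with steps of length `1 / (n + 1)`. -/
noncomputable def fineWalkTransform (v w : Plane) (n : ℕ) (f : Plane → ℂ) : Plane → ℂ :=
  walkTransform (alternatingWalk ((1 / ((n : ℝ) + 1)) • v) ((1 / ((n : ℝ) + 1)) • w)
    ((n + 1) ^ 3)) f

theorem plane_inner_basis (ξ : Plane) :
    ⟪(!₂[1, 0] : Plane), ξ⟫ = ξ 0 ∧ ⟪(!₂[0, 1] : Plane), ξ⟫ = ξ 1 := by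
  simp [PiLp.inner_apply, Fin.sum_univ_two]

theorem plane_inner_diagonal (ξ : Plane) :
    ⟪(!₂[1, 1] : Plane), ξ⟫ = ξ 0 + ξ 1 ∧ ⟪(!₂[1, -1] : Plane), ξ⟫ = ξ 0 - ξ 1 := by
  simp [PiLp.inner_apply, Fin.sum_univ_two, sub_eq_add_neg]

theorem plane_norm_sq (ξ : Plane) : ‖ξ‖ ^ 2 = ξ 0 ^ 2 + ξ 1 ^ 2 := by
  rw [EuclideanSpace.norm_sq_eq, Fin.sum_univ_two]
  simp

theorem plane_sq_add_sq_pos {ξ : Plane} (hξ : ξ ≠ 0) : 0 < ξ 0 ^ 2 + ξ 1 ^ 2 := by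
  rw [← plane_norm_sq]
  exact pow_pos (norm_pos_iff.2 hξ) 2

theorem hasSymbol_rieszTransform_sq_sub_sq (f : Lp ℂ 2 (volume : Measure Plane)) :
    HasSymbol f ((rieszTransform 0 ∘L rieszTransform 0 - rieszTransform 1 ∘L rieszTransform 1) f)
      fun ξ => (((ξ 0 ^ 2 - ξ 1 ^ 2) / (ξ 0 ^ 2 + ξ 1 ^ 2) : ℝ) : ℂ) := by
  have h : ∀ j, HasSymbol f (rieszTransform j (rieszTransform j f))
      fun ξ => rieszSymbol j ξ * rieszSymbol j ξ := fun j =>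
    (hasSymbol_multiplierOp _ (memLp_top_rieszSymbol j) f).trans
      (hasSymbol_multiplierOp _ (memLp_top_rieszSymbol j) _)
  refine (((h 0).sub (h 1)).congr_symbol fun ξ => ?_).congr_ae (Lp.coeFn_sub _ _).symm
  simp only [Pi.sub_apply, rieszSymbol, ← Complex.ofReal_mul, ← Complex.ofReal_sub]
  rw [← plane_norm_sq]
  congr 1
  ring

/-- Since `ζ / conj ζ = ζ ^ 2 / |ζ| ^ 2`, the imaginary part is `2 * ξ 0 * ξ 1 / |ξ| ^ 2`, written
here as the limit symbol for the diagonals `(1, 1)` and `(1, -1)`. The quotient is homogeneous, so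
they need no normalization. -/
theorem ahlforsBeurlingSymbol_eq {ξ : Plane} (hξ : ξ ≠ 0) :
    ahlforsBeurlingSymbol ξ = (((ξ 0 ^ 2 - ξ 1 ^ 2) / (ξ 0 ^ 2 + ξ 1 ^ 2) : ℝ) : ℂ) +
      Complex.I * ((((ξ 0 + ξ 1) ^ 2 - (ξ 0 - ξ 1) ^ 2) /
        ((ξ 0 + ξ 1) ^ 2 + (ξ 0 - ξ 1) ^ 2) : ℝ) : ℂ) := by
  have hpos := plane_sq_add_sq_pos hξ
  have hz : ((ξ 0 : ℂ) + Complex.I * ξ 1) * ((ξ 0 : ℂ) - Complex.I * ξ 1) =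
      ((ξ 0 ^ 2 + ξ 1 ^ 2 : ℝ) : ℂ) := by
    push_cast
    linear_combination -(ξ 1 : ℂ) ^ 2 * Complex.I_sq
  have hne : ((ξ 0 ^ 2 + ξ 1 ^ 2 : ℝ) : ℂ) ≠ 0 := Complex.ofReal_ne_zero.2 hpos.ne'
  have hzne : (ξ 0 : ℂ) - Complex.I * ξ 1 ≠ 0 := fun h => hne (by rw [← hz, h, mul_zero])
  have hconj : conj ((ξ 0 : ℂ) + Complex.I * ξ 1) = ξ 0 - Complex.I * ξ 1 := by
    simp [sub_eq_add_neg]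
  have e2 : ((ξ 0 + ξ 1) ^ 2 - (ξ 0 - ξ 1) ^ 2) / ((ξ 0 + ξ 1) ^ 2 + (ξ 0 - ξ 1) ^ 2) =
      2 * ξ 0 * ξ 1 / (ξ 0 ^ 2 + ξ 1 ^ 2) := by
    rw [div_eq_div_iff (by nlinarith) hpos.ne']
    ring
  rw [ahlforsBeurlingSymbol, hconj, e2, Complex.ofReal_div, Complex.ofReal_div, ← mul_div_assoc,
    ← add_div, div_eq_div_iff hzne hne]
  push_cast
  linear_combination 2 * (ξ 0 : ℂ) * ξ 1 ^ 2 * Complex.I_sq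

variable {p : ℝ}

theorem eLpNorm_fineWalkTransform_le (hp : 1 < p) {f : Plane → ℂ}
    (hf : MemLp f (ENNReal.ofReal p) volume) (v w : Plane) (n : ℕ) :
    eLpNorm (fineWalkTransform v w n f) (ENNReal.ofReal p) volume ≤
      ENNReal.ofReal (max p (p / (p - 1)) - 1) * eLpNorm f (ENNReal.ofReal p) volume :=
  eLpNorm_walkTransform_le hp hf _ (norm_snd_of_mem_alternatingWalk _ _ _)

theorem eLpNorm_rieszTransform_sq_sub_sq_le (hp : 1 < p) (f : Lp ℂ 2 (volume : Measure Plane))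
    (hf : MemLp f (ENNReal.ofReal p) volume) :
    eLpNorm ((rieszTransform 0 ∘L rieszTransform 0 - rieszTransform 1 ∘L rieszTransform 1) f)
        (ENNReal.ofReal p) volume ≤
      ENNReal.ofReal (max p (p / (p - 1)) - 1) * eLpNorm f (ENNReal.ofReal p) volume := by
  refine (hasSymbol_rieszTransform_sq_sub_sq f).eLpNorm_le_of_tendsto (K := 1)
    (fun n => hasSymbol_walkTransform f _)
    (fun n ξ => norm_walkSymbol_le_one ξ _ (norm_snd_of_mem_alternatingWalk _ _ _)) ?_
    (fun n => eLpNorm_fineWalkTransform_le hp hf !₂[1, 0] !₂[0, 1] n)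
  filter_upwards [Measure.ae_ne volume (0 : Plane)] with ξ hξ
  have h := tendsto_walkSymbol_alternatingWalk (v := (!₂[1, 0] : Plane)) (w := !₂[0, 1]) (ξ := ξ)
  rw [(plane_inner_basis ξ).1, (plane_inner_basis ξ).2] at h
  exact h (plane_sq_add_sq_pos hξ)

theorem eLpNorm_ahlforsBeurling_le (hp : 1 < p) (f : Lp ℂ 2 (volume : Measure Plane))
    (hf : MemLp f (ENNReal.ofReal p) volume) :
    eLpNorm (ahlforsBeurling f) (ENNReal.ofReal p) volume ≤
      ENNReal.ofReal (2 * (max p (p / (p - 1)) - 1)) * eLpNorm f (ENNReal.ofReal p) volume := by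
  refine (hasSymbol_multiplierOp _ memLp_top_ahlforsBeurlingSymbol f).eLpNorm_le_of_tendsto
    (K := 2) (gs := fun n => fineWalkTransform !₂[1, 0] !₂[0, 1] n f +
      Complex.I • fineWalkTransform !₂[1, 1] !₂[1, -1] n f)
    (fun n => (hasSymbol_walkTransform f _).add
      ((hasSymbol_walkTransform f _).const_smul Complex.I))
    (fun n ξ => ?_) ?_ (fun n => ?_)
  · refine NNReal.coe_le_coe.1 ((norm_add_le _ _).trans ?_)
    rw [Pi.smul_apply, norm_smul, Complex.norm_I, one_mul]
    refine (add_le_add (norm_walkSymbol_le_one ξ _ (norm_snd_of_mem_alternatingWalk _ _ _))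
      (norm_walkSymbol_le_one ξ _ (norm_snd_of_mem_alternatingWalk _ _ _))).trans ?_
    norm_num
  · filter_upwards [Measure.ae_ne volume (0 : Plane)] with ξ hξ
    have hpos := plane_sq_add_sq_pos hξ
    have h := tendsto_walkSymbol_alternatingWalk (v := (!₂[1, 0] : Plane)) (w := !₂[0, 1]) (ξ := ξ)
    have h' := tendsto_walkSymbol_alternatingWalk (v := (!₂[1, 1] : Plane)) (w := !₂[1, -1])
      (ξ := ξ)
    rw [(plane_inner_basis ξ).1, (plane_inner_basis ξ).2] at h
    rw [(plane_inner_diagonal ξ).1, (plane_inner_diagonal ξ).2] at h'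
    rw [ahlforsBeurlingSymbol_eq hξ]
    exact (h hpos).add ((h' (by nlinarith)).const_mul Complex.I)
  · have h1 := eLpNorm_fineWalkTransform_le hp hf !₂[1, 0] !₂[0, 1] n
    have h2 := eLpNorm_fineWalkTransform_le hp hf !₂[1, 1] !₂[1, -1] n
    have hm1 : MemLp (fineWalkTransform !₂[1, 0] !₂[0, 1] n f) _ volume := hf.walkTransform _
    have hm2 : MemLp (fineWalkTransform !₂[1, 1] !₂[1, -1] n f) _ volume := hf.walkTransform _
    refine (eLpNorm_add_le hm1.1 (hm2.1.const_smul Complex.I)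
      (ENNReal.one_le_ofReal.2 hp.le)).trans ?_
    rw [eLpNorm_const_smul, ENNReal.ofReal_mul zero_le_two, ENNReal.ofReal_ofNat, mul_assoc,
      two_mul]
    refine add_le_add h1 ?_
    have hI : ‖Complex.I‖ₑ = 1 := by rw [← ofReal_norm, Complex.norm_I, ENNReal.ofReal_one]
    rwa [hI, one_mul]

end Plane

theorem theorem3p1 (p : ℝ) [Fact (1 ≤ ENNReal.ofReal p)] :
    (2 ≤ p →
      LpNormLE (ENNReal.ofReal p)
        (rieszTransform 0 ∘L rieszTransform 0 - rieszTransform 1 ∘L rieszTransform 1)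
        (p - 1)) ∧
    (1 < p →
      LpNormLE (ENNReal.ofReal p) ahlforsBeurling (2 * (max p (p / (p - 1)) - 1))) := by
  refine ⟨fun hp => ?_, fun hp => ?_⟩
  · refine lpNormLE_of_eLpNorm_le ENNReal.ofReal_ne_top (by linarith) fun f hf => ?_
    have h := eLpNorm_rieszTransform_sq_sub_sq_le (by linarith) f hf
    rwa [max_eq_left] at h
    rw [div_le_iff₀ (by linarith)]
    nlinarith
  · refine lpNormLE_of_eLpNorm_le ENNReal.ofReal_ne_top ?_ (eLpNorm_ahlforsBeurling_le hp)
    linarith [le_max_left p (p / (p - 1))]
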